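/- **Setting.** A *periodic configuration* in $\mathbb{R}^n$ is a nonempty disjoint union $\mathcal{P}=\bigcup_{j=1}^N(\Lambda+v_j)$ of finitely many translates of a full-rank lattice $\Lambda\subset\mathbb{R}^n$. Its point density is $\delta(\mathcal{P})=N/\operatorname{covol}(\Lambda)$, and for a Schwartz function $f$ its average pair sum is $$\Sigma_f(\mathcal{P})=\frac1N\sum_{j,k=1}^N\sum_{x\in\Lambda}f(x+v_j-v_k).$$ A periodic configuration $\mathcal{Q}$ is a *formal dual* of $\mathcal{P}$ if $\Sigma_f(\mathcal{P})=\delta(\mathcal{P})\,\Sigma_{\widehat f}(\mathcal{Q})$ for every Schwartz function $f\colon\mathbb{R}^n\to\mathbb{R}$, where $\widehat f(y)=\int_{\mathbb{R}^n}f(x)e^{-2\pi i\langle x,y\rangle}\,dx$. A *periodic Barlow packing* is given by an integer $k\ge1$ (the number of hexagonal layers in a period), elements $a_0,\dots,a_{k-1}\in\{0,1,2\}$ with $a_j\ne a_{j+1}$ for all $j$ (indices modulo $k$), two unit vectors $v_1,v_2\in\mathbb{R}^3$ making an angle of $\pi/3$, and a vector $v_3$ of length $k\sqrt{2/3}$ orthogonal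 to $v_1$ and $v_2$. It is the periodic configuration consisting of the translates of the lattice $\Lambda=\mathbb{Z}v_1+\mathbb{Z}v_2+\mathbb{Z}v_3$ by the $k$ vectors $a_j(v_1+v_2)/3+jv_3/k$, $0\le j<k$. **Proposition 5.1.** The only periodic Barlow packing that has a formal dual is the face-centered cubic lattice. That is, a periodic Barlow packing in $\mathbb{R}^3$ has a formal dual if and only if it is the image, under an isometry of $\mathbb{R}^3$, of the face-centered cubic lattice $$\Big\{\tfrac1{\sqrt2}(m_0,m_1,m_2) : m_i\in\mathbb{Z},\ m_0+m_1+m_2\ \text{even}\Big\}.$$ -/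

import Mathlib

open scoped SchwartzMap FourierTransform

/-- A periodic configuration in `ℝⁿ`: a disjoint union of finitely many (at least one) translates
`Λ + v`, `v ∈ reps`, of a full-rank lattice `Λ`. -/
structure PeriodicConfiguration (n : ℕ) where
  /-- The underlying lattice `Λ`. -/
  lattice : Submodule ℤ (EuclideanSpace ℝ (Fin n))
  discrete : DiscreteTopology lattice
  isZLattice : IsZLattice ℝ lattice
  /-- The translation vectors. -/
  reps : Finset (EuclideanSpace ℝ (Fin n))
  nonempty : reps.Nonempty
  /-- Different translation vectors give different cosets of `Λ`. -/
  distinct : ∀ v ∈ reps, ∀ w ∈ reps, v - w ∈ lattice → v = w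

namespace PeriodicConfiguration

attribute [instance] discrete isZLattice

variable {n : ℕ}

/-- The points of the configuration. -/
def carrier (P : PeriodicConfiguration n) : Set (EuclideanSpace ℝ (Fin n)) :=
  {x | ∃ v ∈ P.reps, x - v ∈ P.lattice}

/-- The point density: the number of translates divided by the covolume of the lattice. -/
noncomputable def density (P : PeriodicConfiguration n) : ℝ :=
  (P.reps.card : ℝ) / ZLattice.covolume P.lattice

/-- The average pair sum `(1/N) ∑_{v,w} ∑_{x ∈ Λ} f (x + v - w)`. -/
noncomputable def avgPairSum (P : PeriodicConfiguration n)
    (f : EuclideanSpace ℝ (Fin n) → ℂ) : ℂ :=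
  (1 / (P.reps.card : ℂ)) *
    ∑ v ∈ P.reps, ∑ w ∈ P.reps,
      ∑' x : P.lattice, f ((x : EuclideanSpace ℝ (Fin n)) + v - w)

/-- `P` and `Q` are formally dual: `Σ_f(P) = δ(P) Σ_{𝓕 f}(Q)` for every real-valued Schwartz
function `f`.  Here `𝓕 f (y) = ∫ f(x) exp(-2πi⟨x,y⟩) dx`; as this is complex-valued in general,
the identity is stated in `ℂ`. -/
def FormallyDual (P Q : PeriodicConfiguration n) : Prop :=
  ∀ f : 𝓢(EuclideanSpace ℝ (Fin n), ℝ),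
    P.avgPairSum (fun x => (f x : ℂ)) =
      (P.density : ℂ) * Q.avgPairSum (𝓕 (fun x => (f x : ℂ)))

/-- `P` has a formal dual. -/
def HasFormalDual (P : PeriodicConfiguration n) : Prop :=
  ∃ Q : PeriodicConfiguration n, P.FormallyDual Q

end PeriodicConfiguration

/-- The data from which a periodic Barlow packing is constructed. -/
structure BarlowData where
  /-- The number of hexagonal layers in a period. -/
  k : ℕ
  k_pos : 0 < k
  /-- The offsets of the layers. -/
  a : ZMod k → ZMod 3
  /-- Adjacent layers have different offsets (indices are taken modulo `k`). -/
  a_ne : ∀ j, a j ≠ a (j + 1)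
  v₁ : EuclideanSpace ℝ (Fin 3)
  v₂ : EuclideanSpace ℝ (Fin 3)
  v₃ : EuclideanSpace ℝ (Fin 3)
  norm_v₁ : ‖v₁‖ = 1
  norm_v₂ : ‖v₂‖ = 1
  angle_v₁_v₂ : InnerProductGeometry.angle v₁ v₂ = Real.pi / 3
  norm_v₃ : ‖v₃‖ = k * √(2 / 3)
  orth_v₁_v₃ : inner ℝ v₁ v₃ = 0
  orth_v₂_v₃ : inner ℝ v₂ v₃ = 0

namespace BarlowData

/-- The lattice spanned by `v₁`, `v₂`, `v₃`. -/
def lattice (B : BarlowData) : Submodule ℤ (EuclideanSpace ℝ (Fin 3)) :=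
  Submodule.span ℤ (Set.range ![B.v₁, B.v₂, B.v₃])

/-- The translation vector `a_j (v₁ + v₂) / 3 + j v₃ / k` of the `j`-th layer, where `a_j` is
read as an element of `{0, 1, 2}`. -/
noncomputable def shift (B : BarlowData) (j : ℕ) : EuclideanSpace ℝ (Fin 3) :=
  (((B.a (j : ZMod B.k)).val : ℝ) / 3) • (B.v₁ + B.v₂) + ((j : ℝ) / (B.k : ℝ)) • B.v₃

theorem linearIndependent (B : BarlowData) :
    LinearIndependent ℝ ![B.v₁, B.v₂, B.v₃] := by
  have h12 : inner ℝ B.v₁ B.v₂ = 1 / 2 := by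
    have h := InnerProductGeometry.cos_angle_mul_norm_mul_norm B.v₁ B.v₂
    rw [B.angle_v₁_v₂, B.norm_v₁, B.norm_v₂, Real.cos_pi_div_three] at h
    linarith
  have h21 : inner ℝ B.v₂ B.v₁ = 1 / 2 := by rw [real_inner_comm]; exact h12
  have h11 : inner ℝ B.v₁ B.v₁ = 1 := by rw [real_inner_self_eq_norm_sq, B.norm_v₁]; norm_num
  have h22 : inner ℝ B.v₂ B.v₂ = 1 := by rw [real_inner_self_eq_norm_sq, B.norm_v₂]; norm_num
  have h13 := B.orth_v₁_v₃
  have h23 := B.orth_v₂_v₃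
  have h33 : inner ℝ B.v₃ B.v₃ ≠ 0 := by
    have hk : (0 : ℝ) < B.k := by exact_mod_cast B.k_pos
    have : 0 < ‖B.v₃‖ := by rw [B.norm_v₃]; positivity
    rw [real_inner_self_eq_norm_sq]
    positivity
  rw [Fintype.linearIndependent_iff]
  intro g hg
  simp only [Fin.sum_univ_three, Matrix.cons_val_zero, Matrix.cons_val_one,
    Matrix.cons_val] at hg
  have e1 := congrArg (fun x => inner ℝ B.v₁ x) hg
  have e2 := congrArg (fun x => inner ℝ B.v₂ x) hg
  have e3 := congrArg (fun x => inner ℝ x B.v₃) hg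
  simp only [inner_add_right, inner_smul_right, inner_zero_right, h11, h12, h13, h21, h22,
    h23] at e1 e2
  simp only [inner_add_left, real_inner_smul_left, inner_zero_left, h13, h23] at e3
  have g2 : g 2 = 0 := by
    have : g 2 * inner ℝ B.v₃ B.v₃ = 0 := by linarith
    exact (mul_eq_zero.mp this).resolve_right h33
  intro i
  fin_cases i
  · show g 0 = 0
    linarith
  · show g 1 = 0
    linarith
  · exact g2

theorem exists_basis (B : BarlowData) :
    ∃ b : Module.Basis (Fin 3) ℝ (EuclideanSpace ℝ (Fin 3)), ⇑b = ![B.v₁, B.v₂, B.v₃] :=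
  ⟨basisOfLinearIndependentOfCardEqFinrank B.linearIndependent (by simp), by simp⟩

theorem discrete (B : BarlowData) : DiscreteTopology B.lattice := by
  obtain ⟨b, hb⟩ := B.exists_basis
  unfold lattice
  rw [← hb]
  infer_instance

theorem isZLattice (B : BarlowData) :
    letI := B.discrete
    IsZLattice ℝ B.lattice := by
  have hd := B.discrete
  obtain ⟨b, hb⟩ := B.exists_basis
  refine ⟨?_⟩
  unfold lattice
  rw [← hb, Submodule.span_span_of_tower, b.span_eq]

theorem eq_of_shift_sub_mem (B : BarlowData) {i j : ℕ} (hi : i < B.k) (hj : j < B.k)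
    (h : B.shift i - B.shift j ∈ B.lattice) : i = j := by
  unfold lattice at h
  rw [Submodule.mem_span_range_iff_exists_fun] at h
  obtain ⟨c, hc⟩ := h
  have hk : (0 : ℝ) < B.k := by exact_mod_cast B.k_pos
  have h33 : inner ℝ B.v₃ B.v₃ ≠ 0 := by
    have : 0 < ‖B.v₃‖ := by rw [B.norm_v₃]; positivity
    rw [real_inner_self_eq_norm_sq]
    positivity
  have e := congrArg (fun x => inner ℝ x B.v₃) hc
  simp only [Fin.sum_univ_three, Matrix.cons_val_zero, Matrix.cons_val_one, Matrix.cons_val,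
    shift, inner_add_left, inner_sub_left, real_inner_smul_left, ← Int.cast_smul_eq_zsmul ℝ,
    B.orth_v₁_v₃, B.orth_v₂_v₃] at e
  have e' : ((c 2 : ℝ) - ((i : ℝ) / B.k - (j : ℝ) / B.k)) * inner ℝ B.v₃ B.v₃ = 0 := by
    linarith
  have e2 := (mul_eq_zero.mp e').resolve_right h33
  have e3 : (c 2 : ℝ) * B.k = (i : ℝ) - j := by
    field_simp at e2
    linarith
  have e4 : c 2 * (B.k : ℤ) = (i : ℤ) - j := by exact_mod_cast e3
  have h0 : c 2 = 0 := by
    by_contra hne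
    rcases lt_or_gt_of_ne hne with hlt | hgt <;> nlinarith
  rw [h0] at e4
  omega

open Classical in
/-- The periodic Barlow packing: the union of the `k` cosets of the lattice spanned by
`v₁`, `v₂`, `v₃` by the translation vectors `a_j (v₁ + v₂) / 3 + j v₃ / k`, `0 ≤ j < k`. -/
noncomputable def packing (B : BarlowData) : PeriodicConfiguration 3 where
  lattice := B.lattice
  discrete := B.discrete
  isZLattice := B.isZLattice
  reps := (Finset.range B.k).image B.shift
  nonempty := Finset.Nonempty.image (Finset.nonempty_range_iff.mpr B.k_pos.ne') _
  distinct := by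
    intro v hv w hw h
    simp only [Finset.mem_image, Finset.mem_range] at hv hw
    obtain ⟨i, hi, rfl⟩ := hv
    obtain ⟨j, hj, rfl⟩ := hw
    rw [B.eq_of_shift_sub_mem hi hj h]

end BarlowData

/-- The face-centered cubic lattice `A₃ = D₃`, scaled to have minimal distance `1`: the vectors
`m / √2` with `m ∈ ℤ³` and `m₀ + m₁ + m₂` even. -/
def fccLattice : Set (EuclideanSpace ℝ (Fin 3)) :=
  {x | ∃ m : Fin 3 → ℤ, Even (∑ i, m i) ∧ ∀ i, x i = (m i : ℝ) / √2}

/-!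
# Barlow packings with a formal dual

Let `P` be a periodic Barlow packing with lattice `Λ`. Poisson summation
(`SchwartzMap.tsum_lattice_eq`) writes the average pair sum of `P` as
`δ(P) ∑ 𝓕 f (t) |S(t)|²`, the sum being over the dual lattice of `Λ`, where `S` is the normalized
exponential sum over the translation vectors. Testing formal duality with functions whose Fourier
transform is concentrated near one point shows that, if `Q` is a formal dual of `P`, then `|S(z)|²`
(read as `0` off the dual lattice) is for every `z` the proportion of translation vectors `w` of
`Q` with `w + z ∈ Q` (`PeriodicConfiguration.FormallyDual.pairCount_eq`).

For a Barlow packing `S(t)` depends only on a class `r` modulo `3` and a class `m` modulo `k`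
attached to `t`. It vanishes for `r = 0`, `m ≠ 0`, and has total mass `∑ |S|² = 1` on the row
`r = 1`. If some period of `Q` has `r ≠ 0`, then `|S| = 1` there, so all layers are in phase and
the offsets form an arithmetic progression. Otherwise every translation vector `w` of `Q` has
exactly one step, of class `D w` modulo `k`, into the next row, and following steps permutes the
translation vectors, three steps closing up (`D w + D (S w) + D (S (S w)) = 0`). The
autocorrelation of the layer sequence at distance one has real part `-1/2`, because consecutive
offsets differ; on the side of `Q` this is the average of `Re exp (2πi D w / k)`. Grouping three
consecutive steps, it is at least `-1/2` by the inequality `Re (x + y + z) ≥ -3/2` for unit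
complex numbers with `x y z = 1`, and equality forces `x = y = z` (`Complex.deltoid`). Hence `D` is
constant, so again `|S| = 1` at a point with `r = 1`, and the offsets form an arithmetic
progression (`BarlowData.isCyclic_of_formallyDual`).

A packing whose offsets form an arithmetic progression is a translate of a lattice with a basis of
unit vectors at mutual angles `π/3`, so it is congruent to the face-centered cubic lattice, and
Poisson summation shows that the dual lattice is a formal dual. Conversely, an isometry onto the
face-centered cubic lattice is affine, so the packing is closed under `(x, y, z) ↦ x - y + z`,
which forces the offsets to form an arithmetic progression.
-/

/-! ### Dual lattices -/

section DualLattice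

variable {E : Type*} [NormedAddCommGroup E] [InnerProductSpace ℝ E]

/-- The dual of a `ℤ`-submodule `L` of a Euclidean space: all vectors whose inner product with each
element of `L` is an integer. -/
def dualLattice (L : Submodule ℤ E) : Submodule ℤ E where
  carrier := {t | ∀ x ∈ L, ∃ m : ℤ, inner ℝ x t = m}
  add_mem' {s t} hs ht x hx := by
    obtain ⟨a, ha⟩ := hs x hx
    obtain ⟨b, hb⟩ := ht x hx
    exact ⟨a + b, by rw [inner_add_right, ha, hb]; push_cast; rfl⟩
  zero_mem' x _ := ⟨0, by simp⟩
  smul_mem' c t ht x hx := by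
    obtain ⟨a, ha⟩ := ht x hx
    exact ⟨c * a, by rw [← Int.cast_smul_eq_zsmul ℝ, inner_smul_right, ha]; push_cast; rfl⟩

theorem mem_dualLattice_span {ι : Type*} {b : ι → E} {t : E} :
    t ∈ dualLattice (Submodule.span ℤ (Set.range b)) ↔ ∀ i, ∃ m : ℤ, inner ℝ (b i) t = m := by
  refine ⟨fun h i => h _ (Submodule.subset_span ⟨i, rfl⟩), fun h x hx => ?_⟩
  induction hx using Submodule.span_induction with
  | mem x hx => obtain ⟨i, rfl⟩ := hx; exact h i
  | zero => exact ⟨0, by simp⟩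
  | add x y _ _ hx hy =>
    obtain ⟨a, ha⟩ := hx
    obtain ⟨b, hb⟩ := hy
    exact ⟨a + b, by rw [inner_add_left, ha, hb]; push_cast; rfl⟩
  | smul c x _ hx =>
    obtain ⟨a, ha⟩ := hx
    exact ⟨c * a, by rw [← Int.cast_smul_eq_zsmul ℝ, real_inner_smul_left, ha]; push_cast; rfl⟩

theorem dualLattice_span_eq {ι : Type*} [Finite ι] [DecidableEq ι] {b d : Module.Basis ι ℝ E}
    (hd : ∀ i j, inner ℝ (b i) (d j) = if i = j then 1 else 0) :
    dualLattice (Submodule.span ℤ (Set.range b)) = Submodule.span ℤ (Set.range d) := by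
  cases nonempty_fintype ι
  ext t
  rw [mem_dualLattice_span, d.mem_span_iff_repr_mem ℤ]
  have key : ∀ i, inner ℝ (b i) t = d.repr t i := by
    intro i
    conv_lhs => rw [← d.sum_repr t]
    simp [-Module.Basis.sum_repr, inner_sum, inner_smul_right, hd]
  refine forall_congr' fun i => ?_
  rw [key]
  constructor
  · rintro ⟨m, hm⟩; exact ⟨m, by simp [hm]⟩
  · rintro ⟨m, hm⟩; exact ⟨m, by simp [← hm]⟩

variable [FiniteDimensional ℝ E]

theorem exists_dual_basis {ι : Type*} [Finite ι] [DecidableEq ι] (b : Module.Basis ι ℝ E) :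
    ∃ d : Module.Basis ι ℝ E, ∀ i j, inner ℝ (b i) (d j) = if i = j then 1 else 0 := by
  have hB : LinearMap.BilinForm.Nondegenerate (innerₗ E) := by
    refine LinearMap.BilinForm.Nondegenerate.ofSeparatingLeft ?_
    intro x hx
    simpa using hx x
  refine ⟨LinearMap.BilinForm.dualBasis (innerₗ E) hB b, fun i j => ?_⟩
  rw [real_inner_comm]
  exact LinearMap.BilinForm.apply_dualBasis_left hB b j i

theorem exists_forall_inner_eq {ι : Type*} [Finite ι] (b : Module.Basis ι ℝ E) (c : ι → ℝ) :
    ∃ t : E, ∀ i, inner ℝ (b i) t = c i := by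
  classical
  cases nonempty_fintype ι
  obtain ⟨d, hd⟩ := exists_dual_basis b
  exact ⟨∑ j, c j • d j, fun i => by simp [inner_sum, inner_smul_right, hd]⟩

instance (L : Submodule ℤ E) [DiscreteTopology L] [IsZLattice ℝ L] :
    DiscreteTopology (dualLattice L) := by
  classical
  let b := Module.Free.chooseBasis ℤ L
  obtain ⟨d, hd⟩ := exists_dual_basis (b.ofZLatticeBasis ℝ L)
  rw [← b.ofZLatticeBasis_span ℝ, dualLattice_span_eq hd]
  infer_instance

end DualLattice

/-! ### Poisson summation for lattices -/

theorem fourierChar_intCast (m : ℤ) : Real.fourierChar (m : ℝ) = 1 := by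
  ext
  rw [Real.fourierChar_apply, Circle.coe_one, Complex.exp_eq_one_iff]
  exact ⟨m, by push_cast; ring⟩

theorem fourierChar_eq_one_iff {x : ℝ} : Real.fourierChar x = 1 ↔ ∃ m : ℤ, x = m := by
  refine ⟨fun h => ?_, fun ⟨m, hm⟩ => hm ▸ fourierChar_intCast m⟩
  have h1 := congrArg (fun c : Circle => (c : ℂ)) h
  simp only [Real.fourierChar_apply, Circle.coe_one, Complex.exp_eq_one_iff] at h1
  obtain ⟨m, hm⟩ := h1
  refine ⟨m, ?_⟩
  have hpi : (2 * (Real.pi : ℂ) * Complex.I) ≠ 0 := Complex.two_pi_I_ne_zero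
  have h2 : (x : ℂ) = m := mul_right_cancel₀ hpi (by rw [← hm]; push_cast; ring)
  exact_mod_cast h2

section Poisson
open MeasureTheory

variable {E : Type*} [NormedAddCommGroup E] [InnerProductSpace ℝ E] [FiniteDimensional ℝ E]
  (L : Submodule ℤ E) [DiscreteTopology L]

/-- The translates of a Schwartz function by lattice vectors are dominated on each ball by a
summable family, by Peetre's inequality `1 + ‖l‖ ≤ (1 + ‖y‖) (1 + ‖l + y‖)`. -/
theorem SchwartzMap.exists_summable_bound (f : 𝓢(E, ℂ)) (R : ℝ) :
    ∃ u : L → ℝ, Summable u ∧ ∀ (l : L) (y : E), ‖y‖ ≤ R → ‖f (l + y)‖ ≤ u l := by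
  set N := Module.finrank ℤ L + 1
  obtain ⟨C, hC0, hC⟩ : ∃ C : ℝ, 0 ≤ C ∧ ∀ x, (1 + ‖x‖) ^ N * ‖f x‖ ≤ C := by
    have hf := fun x => SchwartzMap.one_add_le_sup_seminorm_apply (𝕜 := ℝ) (m := (N, 0))
      le_rfl le_rfl f x
    simp only [norm_iteratedFDeriv_zero] at hf
    exact ⟨_, le_trans (by positivity) (hf 0), hf⟩
  refine ⟨fun l => C * (1 + |R|) ^ N * ((1 + ‖l‖)⁻¹) ^ N, ?_, fun l y hy => ?_⟩
  · refine Summable.mul_left _ ?_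
    refine Summable.of_norm_bounded_eventually (g := fun l : L => ‖l‖⁻¹ ^ N)
      (ZLattice.summable_norm_pow_inv L N (Nat.lt_succ_self _)) ?_
    filter_upwards [(Set.finite_singleton (0 : L)).compl_mem_cofinite] with l hl
    have hl0 : 0 < ‖l‖ := norm_pos_iff.mpr hl
    rw [Real.norm_of_nonneg (by positivity)]
    gcongr
    linarith
  · have h1 : 1 + ‖l‖ ≤ (1 + |R|) * (1 + ‖(l : E) + y‖) := by
      have h2 : ‖l‖ ≤ ‖(l : E) + y‖ + ‖y‖ := by
        simpa using norm_sub_le ((l : E) + y) y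
      have h3 : ‖y‖ ≤ |R| := hy.trans (le_abs_self R)
      nlinarith [norm_nonneg ((l : E) + y), abs_nonneg R]
    have h4 := hC ((l : E) + y)
    have h5 : 0 < 1 + ‖l‖ := by positivity
    beta_reduce
    rw [inv_pow, ← div_eq_mul_inv, le_div_iff₀ (by positivity)]
    calc ‖f (l + y)‖ * (1 + ‖l‖) ^ N
        ≤ ‖f (l + y)‖ * ((1 + |R|) * (1 + ‖(l : E) + y‖)) ^ N := by gcongr
      _ = (1 + |R|) ^ N * ((1 + ‖(l : E) + y‖) ^ N * ‖f (l + y)‖) := by rw [mul_pow]; ring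
      _ ≤ (1 + |R|) ^ N * C := by gcongr
      _ = C * (1 + |R|) ^ N := mul_comm _ _

theorem SchwartzMap.summable_lattice (f : 𝓢(E, ℂ)) (y : E) :
    Summable fun l : L => f (l + y) := by
  obtain ⟨u, hu, h⟩ := f.exists_summable_bound L ‖y‖
  exact Summable.of_norm_bounded hu fun l => h l y le_rfl

theorem SchwartzMap.continuous_tsum_lattice (f : 𝓢(E, ℂ)) :
    Continuous fun y : E => ∑' l : L, f (l + y) := by
  rw [continuous_iff_continuousAt]
  intro y
  obtain ⟨u, hu, h⟩ := f.exists_summable_bound L (‖y‖ + 1)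
  have hc : ContinuousOn (fun y : E => ∑' l : L, f (l + y)) (Metric.ball 0 (‖y‖ + 1)) := by
    refine continuousOn_tsum (fun l => ?_) hu fun l z hz => h l z ?_
    · exact (f.continuous.comp (continuous_const.add continuous_id)).continuousOn
    · exact (mem_ball_zero_iff.mp hz).le
  exact hc.continuousAt (Metric.isOpen_ball.mem_nhds (by simp))

variable [MeasurableSpace E] [BorelSpace E] [IsZLattice ℝ L]

/-- Unfolding: integrating the periodization of `f` against a character that is trivial on the
lattice gives the Fourier transform of `f`. -/
theorem SchwartzMap.integral_fundamentalDomain_tsum {ι : Type*} [Fintype ι]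
    (b : Module.Basis ι ℤ L) (f : 𝓢(E, ℂ)) {t : E} (ht : t ∈ dualLattice L) :
    ∫ y in ZSpan.fundamentalDomain (b.ofZLatticeBasis ℝ L),
      Real.fourierChar (-inner ℝ y t) • ∑' l : L, f (l + y) = 𝓕 f t := by
  have hF := ZLattice.isAddFundamentalDomain b (volume : Measure E)
  set F := ZSpan.fundamentalDomain (b.ofZLatticeBasis ℝ L) with hFdef
  have hbdd : Bornology.IsBounded F := ZSpan.fundamentalDomain_isBounded _
  have hfin : volume F < ⊤ := hbdd.measure_lt_top
  have : IsFiniteMeasure (volume.restrict F) := ⟨by simpa using hfin⟩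
  obtain ⟨R, hR⟩ := hbdd.exists_norm_le
  obtain ⟨u, hu, h⟩ := f.exists_summable_bound L R
  have hmeas : MeasurableSet F := ZSpan.fundamentalDomain_measurableSet _
  have hcont (l : L) : Continuous fun y : E => Real.fourierChar (-inner ℝ y t) • f (l + y) := by
    have := f.continuous
    have := Real.continuous_fourierChar
    fun_prop
  have hbound (l : L) : ∀ᵐ y ∂(volume.restrict F),
      ‖Real.fourierChar (-inner ℝ y t) • f (l + y)‖ ≤ u l := by
    filter_upwards [ae_restrict_mem hmeas] with y hy
    rw [Circle.norm_smul]
    exact h l y (hR y hy)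
  have hint (l : L) : Integrable (fun y : E => Real.fourierChar (-inner ℝ y t) • f (l + y))
      (volume.restrict F) :=
    Integrable.of_bound (hcont l).aestronglyMeasurable (u l) (hbound l)
  have hint' : Integrable (fun y : E => Real.fourierChar (-inner ℝ y t) • f y) := by
    refine f.integrable.mono ?_ (Filter.Eventually.of_forall fun y => by rw [Circle.norm_smul])
    have := f.continuous
    have := Real.continuous_fourierChar
    exact Continuous.aestronglyMeasurable (by fun_prop)
  have : VAddInvariantMeasure L E volume :=
    ⟨fun l s _ => measure_preimage_add volume (l : E) s⟩
  have : MeasurableConstVAdd L E := ⟨fun l => measurable_const_add (l : E)⟩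
  rw [SchwartzMap.fourier_coe, Real.fourier_eq, hF.integral_eq_tsum'' _ hint']
  have hsum : Summable fun l : L =>
      ∫ y in F, ‖Real.fourierChar (-inner ℝ y t) • f (l + y)‖ := by
    refine Summable.of_nonneg_of_le (fun l => by positivity) (fun l => ?_)
      (hu.mul_right (volume.real F))
    have := norm_setIntegral_le_of_norm_le_const_ae' (μ := volume) (s := F) (C := u l)
      (f := fun y => ‖Real.fourierChar (-inner ℝ y t) • f (l + y)‖) hfin (by
        filter_upwards [(ae_restrict_iff' hmeas).mp (hbound l)] with y hy hyF
        simpa using hy hyF)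
    exact (Real.le_norm_self _).trans this
  have hswap := integral_tsum_of_summable_integral_norm hint hsum
  calc _ = ∫ y in F, ∑' l : L, Real.fourierChar (-inner ℝ y t) • f (l + y) := by
        congr 1
        ext y
        simp_rw [Circle.smul_def]
        rw [tsum_const_smul'']
    _ = _ := hswap.symm
    _ = _ := by
        congr 1
        ext l
        congr 1
        ext y
        obtain ⟨m, hm⟩ := ht l l.2
        have hv : l +ᵥ y = (l : E) + y := rfl
        rw [hv, inner_add_left, hm, neg_add, AddChar.map_add_eq_mul, ← Int.cast_neg,
          fourierChar_intCast, one_mul]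

/-- Coordinates with respect to a basis of the lattice multiply volume by the inverse of the
covolume. -/
theorem ZLattice.integral_image_equivFun {ι : Type*} [Fintype ι] (b : Module.Basis ι ℤ L)
    (s : Set E) (g : E → ℂ) :
    ∫ x in (b.ofZLatticeBasis ℝ L).equivFun '' s, g ((b.ofZLatticeBasis ℝ L).equivFun.symm x) =
      ((ZLattice.covolume L : ℝ) : ℂ)⁻¹ * ∫ y in s, g y := by
  set A := (b.ofZLatticeBasis ℝ L).equivFun with hA
  let e : E ≃ᵐ (ι → ℝ) := (A.toContinuousLinearEquiv.toHomeomorph).toMeasurableEquiv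
  have he : ∀ x, e x = A x := fun x => rfl
  have hcov := ZLattice.covolume_pos L (volume : Measure E)
  have hmap : (volume : Measure E).map e =
      ENNReal.ofReal (ZLattice.covolume L) • (volume : Measure (ι → ℝ)) := by
    ext u hu
    rw [MeasurableEquiv.map_apply, Measure.smul_apply, smul_eq_mul]
    have h1 := ZLattice.volume_image_eq_volume_div_covolume' L b
      (s := e ⁻¹' u) (e.measurable hu).nullMeasurableSet
    have h2 : A '' (e ⁻¹' u) = u := by
      have : e ⁻¹' u = A ⁻¹' u := rfl
      rw [this, Set.image_preimage_eq _ A.surjective]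
    rw [← hA, h2] at h1
    rw [h1, ENNReal.mul_div_cancel (by simpa using hcov) (by simp)]
  have h3 : ∫ y in s, g y = ∫ y in e ⁻¹' (A '' s), (fun x => g (A.symm x)) (e y) := by
    have : e ⁻¹' (A '' s) = s := by
      have : e ⁻¹' (A '' s) = A ⁻¹' (A '' s) := rfl
      rw [this, Set.preimage_image_eq _ A.injective]
    rw [this]
    simp [he]
  rw [h3, ← e.measurableEmbedding.setIntegral_map (fun x => g (A.symm x)) (A '' s), hmap,
    Measure.restrict_smul, integral_smul_measure, ENNReal.toReal_ofReal hcov.le,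
    Complex.real_smul, ← mul_assoc, inv_mul_cancel₀ (by exact_mod_cast hcov.ne'), one_mul]

end Poisson

section Poisson
open MeasureTheory

theorem mFourier_coe {ι : Type*} [Fintype ι] (m : ι → ℤ) (x : ι → ℝ) :
    UnitAddTorus.mFourier m (fun i => (x i : UnitAddCircle)) =
      Real.fourierChar (∑ i, m i * x i) := by
  rw [Real.fourierChar_apply]
  change ∏ i, fourier (m i) (x i : UnitAddCircle) = _
  simp_rw [fourier_coe_apply]
  rw [← Complex.exp_sum]
  congr 1
  push_cast
  rw [Finset.mul_sum, Finset.sum_mul]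
  refine Finset.sum_congr rfl fun i _ => ?_
  ring

theorem volume_setOf_Ioc_ae_eq_Ico {ι : Type*} [Fintype ι] :
    {x : ι → ℝ | ∀ i, x i ∈ Set.Ioc (0 : ℝ) (0 + 1)} =ᵐ[volume]
      {x : ι → ℝ | ∀ i, x i ∈ Set.Ico (0 : ℝ) 1} := by
  have h1 := Measure.univ_pi_Ioc_ae_eq_Icc (μ := fun _ : ι => (volume : Measure ℝ))
    (f := fun _ => 0) (g := fun _ => 1)
  have h2 := Measure.univ_pi_Ico_ae_eq_Icc (μ := fun _ : ι => (volume : Measure ℝ))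
    (f := fun _ => 0) (g := fun _ => 1)
  have h3 := h1.trans h2.symm
  rw [zero_add]
  simp only [Set.pi, Set.mem_univ, true_implies] at h3
  exact h3

variable {E : Type*} [NormedAddCommGroup E] [InnerProductSpace ℝ E] [FiniteDimensional ℝ E]
  (L : Submodule ℤ E) [DiscreteTopology L] [MeasurableSpace E] [BorelSpace E] [IsZLattice ℝ L]

/-- The **Poisson summation formula** for a translate of a full-rank lattice. -/
theorem SchwartzMap.tsum_lattice_eq (f : 𝓢(E, ℂ)) (x : E) :
    ∑' l : L, f (l + x) = ((ZLattice.covolume L : ℝ) : ℂ)⁻¹ *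
      ∑' t : dualLattice L, Real.fourierChar (inner ℝ x (t : E)) • 𝓕 f (t : E) := by
  classical
  let b := Module.Free.chooseBasis ℤ L
  set ι := Module.Free.ChooseBasisIndex ℤ L
  set B := b.ofZLatticeBasis ℝ L with hB
  set A := B.equivFun with hA
  obtain ⟨d, hd⟩ := exists_dual_basis B
  have hspan : Submodule.span ℤ (Set.range B) = L := b.ofZLatticeBasis_span ℝ
  -- the dual lattice is parametrized by integer vectors
  let T (m : ι → ℤ) : E := ∑ i, (m i : ℝ) • d i
  have hBT (m : ι → ℤ) (i : ι) : inner ℝ (B i) (T m) = m i := by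
    simp [T, inner_sum, inner_smul_right, hd]
  have hTmem (m : ι → ℤ) : T m ∈ dualLattice L := by
    rw [← hspan, mem_dualLattice_span]
    exact fun i => ⟨m i, hBT m i⟩
  have hxT (y : E) (m : ι → ℤ) : inner ℝ y (T m) = ∑ i, (m i : ℝ) * A y i := by
    conv_lhs => rw [← B.sum_equivFun y]
    simp [-Module.Basis.equivFun_apply, sum_inner,
      real_inner_smul_left, hBT, mul_comm, hA]
  let φ : (ι → ℤ) ≃ dualLattice L := Equiv.ofBijective (fun m => ⟨T m, hTmem m⟩) <| by
    constructor
    · intro m m' h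
      have h' : T m = T m' := congrArg Subtype.val h
      ext i
      have := hBT m i
      rw [h', hBT m' i] at this
      exact_mod_cast this.symm
    · rintro ⟨t, ht⟩
      have ht' := ht
      rw [← hspan, mem_dualLattice_span] at ht'
      choose m hm using ht'
      refine ⟨m, Subtype.ext (InnerProductSpace.ext_inner_left_basis (𝕜 := ℝ) B fun i => ?_)⟩
      simp only
      rw [hBT, hm]
  -- the periodization, as a function on the torus
  let π : C(ι → ℝ, UnitAddTorus ι) := ⟨fun x i => (x i : UnitAddCircle), by fun_prop⟩
  have hπ : Topology.IsQuotientMap π :=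
    (IsOpenQuotientMap.piMap fun _ : ι => QuotientAddGroup.isOpenQuotientMap_mk).isQuotientMap
  let G : C(ι → ℝ, ℂ) := ⟨fun x => ∑' l : L, f (l + A.symm x),
    (f.continuous_tsum_lattice L).comp A.symm.toContinuousLinearEquiv.continuous⟩
  have hG : Function.FactorsThrough G π := by
    intro x y hxy
    have hmem : A.symm x - A.symm y ∈ L := by
      have : ∀ i, ∃ n : ℤ, x i - y i = n := by
        intro i
        have h1 : (x i : UnitAddCircle) = y i := congrFun hxy i
        obtain ⟨n, hn⟩ := (QuotientAddGroup.eq_iff_sub_mem).mp h1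
        exact ⟨n, by simpa using hn.symm⟩
      rw [← hspan, B.mem_span_iff_repr_mem ℤ, ← map_sub]
      intro i
      obtain ⟨n, hn⟩ := this i
      refine ⟨n, ?_⟩
      have : B.repr (A.symm (x - y)) i = A (A.symm (x - y)) i := rfl
      rw [this, LinearEquiv.apply_symm_apply]
      simp [hn]
    change ∑' l : L, f (l + A.symm x) = ∑' l : L, f (l + A.symm y)
    rw [← (Equiv.addRight (⟨_, hmem⟩ : L)).tsum_eq (fun l : L => f (l + A.symm y))]
    refine tsum_congr fun l => ?_
    congr 1
    simp [add_assoc]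
  let F : C(UnitAddTorus ι, ℂ) := hπ.lift G hG
  have hF (x : ι → ℝ) : F (fun i => (x i : UnitAddCircle)) = ∑' l : L, f (l + A.symm x) := by
    have : (hπ.lift G hG).comp π = G := Topology.IsQuotientMap.lift_comp hπ G hG
    exact congrArg (fun h : C(ι → ℝ, ℂ) => h x) this
  have hbox : {x : ι → ℝ | ∀ i, x i ∈ Set.Ico (0 : ℝ) 1} =
      A '' ZSpan.fundamentalDomain B := by
    ext x
    rw [LinearEquiv.image_eq_preimage_symm, Set.mem_preimage, ZSpan.mem_fundamentalDomain]
    have : ∀ i, B.repr (A.symm x) i = x i := fun i => congrFun (A.apply_symm_apply x) i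
    simp [this]
  have hcoeff (m : ι → ℤ) : UnitAddTorus.mFourierCoeff F m =
      ((ZLattice.covolume L : ℝ) : ℂ)⁻¹ * 𝓕 f (T m) := by
    rw [UnitAddTorus.mFourierCoeff_eq_integral F m (fun _ => 0),
      setIntegral_congr_set volume_setOf_Ioc_ae_eq_Ico, hbox,
      ← f.integral_fundamentalDomain_tsum L b (hTmem m),
      ← ZLattice.integral_image_equivFun L b]
    refine integral_congr_ae (Filter.Eventually.of_forall fun x => ?_)
    beta_reduce
    rw [hF, mFourier_coe, hxT, Circle.smul_def]
    simp [← hB, ← hA, -Module.Basis.equivFun_apply, -Module.Basis.equivFun_symm_apply]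
  have hsummable : Summable (UnitAddTorus.mFourierCoeff F) := by
    have h1 : Summable fun t : dualLattice L => 𝓕 f (t : E) := 
      ((𝓕 f).summable_lattice (dualLattice L) 0).congr fun t => by rw [add_zero]
    have h2 := (φ.summable_iff.mpr h1).mul_left ((ZLattice.covolume L : ℝ) : ℂ)⁻¹
    exact h2.congr fun m => (hcoeff m).symm
  have hsum := UnitAddTorus.hasSum_mFourier_series_apply_of_summable hsummable
    (fun i => (A x i : UnitAddCircle))
  rw [hF, LinearEquiv.symm_apply_apply] at hsum
  rw [← hsum.tsum_eq, ← φ.tsum_eq, ← tsum_mul_left]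
  refine tsum_congr fun m => ?_
  have : ((φ m : dualLattice L) : E) = T m := rfl
  rw [hcoeff, mFourier_coe, this, hxT, Circle.smul_def, smul_eq_mul, smul_eq_mul]
  ring

end Poisson

/-! ### Average pair sums in terms of structure factors -/

namespace PeriodicConfiguration

variable {n : ℕ}

/-- The normalized exponential sum `(1/N) ∑_v exp (2πi⟨v, t⟩)` over the translation vectors. -/
noncomputable def structureFactor (P : PeriodicConfiguration n) (t : EuclideanSpace ℝ (Fin n)) :
    ℂ :=
  (1 / (P.reps.card : ℂ)) * ∑ v ∈ P.reps, (Real.fourierChar (inner ℝ v t) : ℂ)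

theorem card_reps_pos (P : PeriodicConfiguration n) : 0 < P.reps.card :=
  Finset.card_pos.mpr P.nonempty

theorem density_pos (P : PeriodicConfiguration n) : 0 < P.density :=
  div_pos (by exact_mod_cast P.card_reps_pos) (ZLattice.covolume_pos _ _)

theorem avgPairSum_add (P : PeriodicConfiguration n) (f g : 𝓢(EuclideanSpace ℝ (Fin n), ℂ)) :
    P.avgPairSum ⇑(f + g) = P.avgPairSum f + P.avgPairSum g := by
  unfold avgPairSum
  rw [← mul_add]
  congr 1
  simp_rw [← Finset.sum_add_distrib]
  refine Finset.sum_congr rfl fun v _ => Finset.sum_congr rfl fun w _ => ?_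
  simp_rw [add_apply, add_sub_assoc]
  exact (f.summable_lattice P.lattice _).tsum_add (g.summable_lattice P.lattice _)

theorem avgPairSum_smul (P : PeriodicConfiguration n) (c : ℂ)
    (f : 𝓢(EuclideanSpace ℝ (Fin n), ℂ)) :
    P.avgPairSum ⇑(c • f) = c * P.avgPairSum f := by
  unfold avgPairSum
  simp_rw [smul_apply, smul_eq_mul, tsum_mul_left, ← Finset.mul_sum]
  ring

/-- A Schwartz function with real values, regarded as complex-valued. -/
noncomputable def _root_.SchwartzMap.toComplex {E : Type*} [NormedAddCommGroup E] [NormedSpace ℝ E]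
    (f : 𝓢(E, ℝ)) : 𝓢(E, ℂ) := f.postcompCLM Complex.ofRealCLM

/-- The defining identity of formal duality holds for complex-valued Schwartz functions too. -/
theorem FormallyDual.avgPairSum_eq {P Q : PeriodicConfiguration n} (h : P.FormallyDual Q)
    (f : 𝓢(EuclideanSpace ℝ (Fin n), ℂ)) :
    P.avgPairSum f = P.density * Q.avgPairSum (𝓕 f : 𝓢(EuclideanSpace ℝ (Fin n), ℂ)) := by
  have hreal (g : 𝓢(EuclideanSpace ℝ (Fin n), ℝ)) :
      P.avgPairSum g.toComplex =
        P.density * Q.avgPairSum (𝓕 g.toComplex : 𝓢(EuclideanSpace ℝ (Fin n), ℂ)) := h g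
  have hf : f = (f.postcompCLM Complex.reCLM).toComplex +
      Complex.I • (f.postcompCLM Complex.imCLM).toComplex := by
    ext x
    change f x = ((f x).re : ℂ) + Complex.I * ((f x).im : ℂ)
    rw [mul_comm, Complex.re_add_im]
  rw [hf, FourierTransform.fourier_add, FourierTransform.fourier_smul, avgPairSum_add,
    avgPairSum_add, avgPairSum_smul, avgPairSum_smul, hreal, hreal]
  ring

theorem sum_sum_fourierChar (P : PeriodicConfiguration n) (t : EuclideanSpace ℝ (Fin n)) :
    ∑ v ∈ P.reps, ∑ w ∈ P.reps, (Real.fourierChar (inner ℝ (v - w) t) : ℂ) =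
      (P.reps.card : ℂ) ^ 2 * ((‖P.structureFactor t‖ ^ 2 : ℝ) : ℂ) := by
  have hN : (P.reps.card : ℂ) ≠ 0 := by exact_mod_cast P.card_reps_pos.ne'
  rw [structureFactor, Complex.ofReal_pow, ← Complex.mul_conj', map_mul, map_sum, map_div₀,
    map_one, map_natCast]
  have : ∀ v w, (Real.fourierChar (inner ℝ (v - w) t) : ℂ) =
      (Real.fourierChar (inner ℝ v t) : ℂ) *
        (starRingEnd ℂ) (Real.fourierChar (inner ℝ w t) : ℂ) := by
    intro v w
    rw [inner_sub_left, AddChar.map_sub_eq_div, Circle.coe_div, ← Circle.coe_inv_eq_conj,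
      Circle.coe_inv, div_eq_mul_inv]
  simp_rw [this, ← Finset.mul_sum, ← Finset.sum_mul]
  field_simp

/-- Poisson summation for the average pair sum. -/
theorem avgPairSum_eq_tsum (P : PeriodicConfiguration n)
    (f : 𝓢(EuclideanSpace ℝ (Fin n), ℂ)) :
    P.avgPairSum f = P.density * ∑' t : dualLattice P.lattice,
      ((‖P.structureFactor t‖ ^ 2 : ℝ) : ℂ) * 𝓕 f (t : EuclideanSpace ℝ (Fin n)) := by
  have hN : (P.reps.card : ℂ) ≠ 0 := by exact_mod_cast P.card_reps_pos.ne'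
  have hs (x : EuclideanSpace ℝ (Fin n)) : Summable fun t : dualLattice P.lattice =>
      (Real.fourierChar (inner ℝ x (t : EuclideanSpace ℝ (Fin n))) : ℂ) *
        𝓕 f (t : EuclideanSpace ℝ (Fin n)) := by
    refine Summable.of_norm_bounded
      ((𝓕 f).summable_lattice (dualLattice P.lattice) 0).norm fun t => ?_
    rw [norm_mul, Circle.norm_coe, one_mul, add_zero]
  have hpoisson (x : EuclideanSpace ℝ (Fin n)) : ∑' l : P.lattice, f (l + x) =
      ((ZLattice.covolume P.lattice : ℝ) : ℂ)⁻¹ * ∑' t : dualLattice P.lattice,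
        (Real.fourierChar (inner ℝ x (t : EuclideanSpace ℝ (Fin n))) : ℂ) *
          𝓕 f (t : EuclideanSpace ℝ (Fin n)) := f.tsum_lattice_eq P.lattice x
  have hswap : ∑ v ∈ P.reps, ∑ w ∈ P.reps, ∑' t : dualLattice P.lattice,
      (Real.fourierChar (inner ℝ (v - w) (t : EuclideanSpace ℝ (Fin n))) : ℂ) *
        𝓕 f (t : EuclideanSpace ℝ (Fin n)) =
      ∑' t : dualLattice P.lattice, (P.reps.card : ℂ) ^ 2 *
        (((‖P.structureFactor t‖ ^ 2 : ℝ) : ℂ) * 𝓕 f (t : EuclideanSpace ℝ (Fin n))) := by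
    simp_rw [← mul_assoc, ← sum_sum_fourierChar, Finset.sum_mul]
    rw [Summable.tsum_finsetSum fun v _ => summable_sum fun w _ => hs (v - w)]
    exact Finset.sum_congr rfl fun v _ => (Summable.tsum_finsetSum fun w _ => hs (v - w)).symm
  unfold avgPairSum
  simp_rw [add_sub_assoc, hpoisson, ← Finset.mul_sum]
  rw [hswap]
  rw [tsum_mul_left, density]
  push_cast
  field_simp

open Classical in
/-- The number of pairs `(v, w)` of translation vectors such that translation by `z` maps the
coset of `w` onto the coset of `v`. -/
noncomputable def pairCount (Q : PeriodicConfiguration n) (z : EuclideanSpace ℝ (Fin n)) : ℕ :=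
  ((Q.reps ×ˢ Q.reps).filter fun p => z - p.1 + p.2 ∈ Q.lattice).card

theorem _root_.eventually_forall_dist_lt {E : Type*} [NormedAddCommGroup E] [NormedSpace ℝ E]
    [FiniteDimensional ℝ E] (L : Submodule ℤ E) [DiscreteTopology L] (u : E) :
    ∀ᶠ ε in nhdsWithin (0 : ℝ) (Set.Ioi 0), ∀ x ∈ L, dist x u < ε → x = u := by
  have hcl : IsClosed (L : Set E) :=
    AddSubgroup.isClosed_of_discrete (H := L.toAddSubgroup)
  have hfin : (Metric.closedBall u 1 ∩ (L : Set E)).Finite :=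
    Metric.finite_isBounded_inter_isClosed ⟨inferInstanceAs (DiscreteTopology L)⟩
      Metric.isBounded_closedBall hcl
  have hev : ∀ᶠ ε in nhdsWithin (0 : ℝ) (Set.Ioi 0),
      ∀ x ∈ Metric.closedBall u 1 ∩ (L : Set E), dist x u < ε → x = u := by
    rw [hfin.eventually_all]
    intro x _
    by_cases hx : x = u
    · simp [hx]
    · filter_upwards [Ioo_mem_nhdsGT (dist_pos.mpr hx)] with ε hε h
      exact absurd h (not_lt.mpr hε.2.le)
  filter_upwards [hev, Ioo_mem_nhdsGT one_pos] with ε hε h1 x hx hd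
  exact hε x ⟨(hd.trans h1.2).le, hx⟩ hd

/-- Testing formal duality with functions whose Fourier transform is concentrated near a point `z`
compares the two sides coefficient by coefficient. -/
theorem FormallyDual.pairCount_eq {P Q : PeriodicConfiguration n} (h : P.FormallyDual Q)
    (z : EuclideanSpace ℝ (Fin n)) [Decidable (z ∈ dualLattice P.lattice)] :
    (Q.pairCount z : ℝ) = Q.reps.card *
      if z ∈ dualLattice P.lattice then ‖P.structureFactor z‖ ^ 2 else 0 := by
  classical
  have hev1 := eventually_forall_dist_lt (dualLattice P.lattice) z
  have hev2 : ∀ᶠ ε in nhdsWithin (0 : ℝ) (Set.Ioi 0), ∀ p ∈ Q.reps ×ˢ Q.reps,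
      ∀ x ∈ Q.lattice, dist x (z - p.1 + p.2) < ε → x = z - p.1 + p.2 :=
    (Filter.eventually_all_finset _).mpr fun p _ => eventually_forall_dist_lt _ _
  obtain ⟨ε, ⟨h1, h2⟩, hε⟩ := ((hev1.and hev2).and self_mem_nhdsWithin).exists
  let φ : ContDiffBump z := ⟨ε / 2, ε, half_pos hε, half_lt_self hε⟩
  have hφ1 : φ z = 1 := φ.one_of_mem_closedBall (Metric.mem_closedBall_self (half_pos hε).le)
  have hφ0 {y} (hy : ¬ dist y z < ε) : φ y = 0 := φ.zero_of_le_dist (not_lt.mp hy)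
  let H : 𝓢(EuclideanSpace ℝ (Fin n), ℂ) :=
    (φ.hasCompactSupport.toSchwartzMap φ.contDiff).toComplex
  have hH (y) : H y = (φ y : ℂ) := rfl
  have key := h.avgPairSum_eq (𝓕⁻ H)
  rw [avgPairSum_eq_tsum, FourierTransform.fourier_fourierInv_eq] at key
  have key2 := mul_left_cancel₀ (by exact_mod_cast P.density_pos.ne') key
  have hM : (Q.reps.card : ℂ) ≠ 0 := by exact_mod_cast Q.card_reps_pos.ne'
  have hR : ∀ p ∈ Q.reps ×ˢ Q.reps,
      ∑' x : Q.lattice, H ((x : EuclideanSpace ℝ (Fin n)) + p.1 - p.2) =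
        if z - p.1 + p.2 ∈ Q.lattice then 1 else 0 := by
    intro p hp
    have hdist (x : EuclideanSpace ℝ (Fin n)) :
        dist (x + p.1 - p.2) z = dist x (z - p.1 + p.2) := by
      rw [dist_eq_norm, dist_eq_norm]; congr 1; abel
    have hzero (x : Q.lattice) (hx : (x : EuclideanSpace ℝ (Fin n)) ≠ z - p.1 + p.2) :
        H ((x : EuclideanSpace ℝ (Fin n)) + p.1 - p.2) = 0 := by
      rw [hH, hφ0, Complex.ofReal_zero]
      rw [hdist]
      exact fun hlt => hx (h2 p hp x x.2 hlt)
    split_ifs with hmem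
    · rw [tsum_eq_single (⟨_, hmem⟩ : Q.lattice) fun x hx =>
        hzero x fun hx' => hx (Subtype.ext hx')]
      have : z - p.1 + p.2 + p.1 - p.2 = z := by abel
      rw [this, hH, hφ1, Complex.ofReal_one]
    · rw [tsum_congr fun x => hzero x fun hx => hmem (hx ▸ x.2), tsum_zero]
  have hQ : Q.avgPairSum H = (Q.pairCount z : ℂ) / Q.reps.card := by
    unfold avgPairSum pairCount
    rw [← Finset.sum_product', Finset.sum_congr rfl hR, Finset.sum_boole]
    field_simp
  have hL : ∑' t : dualLattice P.lattice, ((‖P.structureFactor t‖ ^ 2 : ℝ) : ℂ) * H t =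
      ((if z ∈ dualLattice P.lattice then ‖P.structureFactor z‖ ^ 2 else 0 : ℝ) : ℂ) := by
    have hzero (t : dualLattice P.lattice) (ht : (t : EuclideanSpace ℝ (Fin n)) ≠ z) :
        ((‖P.structureFactor t‖ ^ 2 : ℝ) : ℂ) * H t = 0 := by
      rw [hH, hφ0 fun hlt => ht (h1 t t.2 hlt), Complex.ofReal_zero, mul_zero]
    split_ifs with hmem
    · rw [tsum_eq_single (⟨z, hmem⟩ : dualLattice P.lattice) fun x hx =>
        hzero x fun hx' => hx (Subtype.ext hx'), hH, hφ1]
      simp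
    · rw [tsum_congr fun x => hzero x fun hx => hmem (hx ▸ x.2), tsum_zero, Complex.ofReal_zero]
  rw [hL, hQ, eq_div_iff hM] at key2
  rw [mul_comm]
  exact_mod_cast key2.symm

end PeriodicConfiguration

/-! ### Unit complex numbers and characters of `ZMod N` -/

section UnitComplex

/-- Equality case of the triangle inequality for unit complex numbers. -/
theorem Complex.eq_of_norm_sum_eq_card {ι : Type*} [Fintype ι] {z : ι → ℂ}
    (hz : ∀ i, ‖z i‖ = 1) (h : ‖∑ i, z i‖ = Fintype.card ι) (i j : ι) : z i = z j := by
  set S := ∑ i, z i with hS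
  have hcard : (0 : ℝ) < Fintype.card ι := by
    exact_mod_cast Fintype.card_pos_iff.mpr ⟨i⟩
  have hS0 : S ≠ 0 := by
    rw [← norm_pos_iff, h]; exact hcard
  have hle (l : ι) : ((starRingEnd ℂ) S * z l).re ≤ ‖S‖ := by
    refine (Complex.re_le_norm _).trans ?_
    rw [norm_mul, hz, mul_one, Complex.norm_conj]
  have hsum : ∑ l, ((starRingEnd ℂ) S * z l).re = ∑ _l : ι, ‖S‖ := by
    rw [← Complex.re_sum, ← Finset.mul_sum, ← hS, Complex.conj_mul', Finset.sum_const,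
      Finset.card_univ, nsmul_eq_mul, ← h, ← Complex.ofReal_pow, Complex.ofReal_re, sq]
  have heq := (Finset.sum_eq_sum_iff_of_le fun l _ => hle l).mp hsum
  have key (l : ι) : (starRingEnd ℂ) S * z l = ‖S‖ := by
    have h1 := heq l (Finset.mem_univ l)
    have h2 : ‖(starRingEnd ℂ) S * z l‖ = ‖S‖ := by
      rw [norm_mul, hz, mul_one, Complex.norm_conj]
    have h3 : ((starRingEnd ℂ) S * z l).re = ‖(starRingEnd ℂ) S * z l‖ := by rw [h1, h2]
    rw [← h2]
    exact (Complex.eq_coe_norm_of_nonneg (Complex.re_eq_norm.mp h3))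
  exact mul_left_cancel₀ ((map_ne_zero (starRingEnd ℂ)).mpr hS0) ((key i).trans (key j).symm)

/-- The region traced out by `x + y + z` with `x, y, z` on the unit circle and `x y z = 1` is
bounded by a deltoid; its leftmost points are the two non-real cusps, where `x = y = z`. -/
theorem Complex.deltoid {x y z : ℂ} (hx : ‖x‖ = 1) (hy : ‖y‖ = 1) (hxyz : x * y * z = 1) :
    -(3 / 2) ≤ (x + y + z).re ∧ ((x + y + z).re = -(3 / 2) → x = y) := by
  have hxx : x.re * x.re + x.im * x.im = 1 := by
    rw [← Complex.normSq_apply, Complex.normSq_eq_norm_sq, hx, one_pow]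
  have hyy : y.re * y.re + y.im * y.im = 1 := by
    rw [← Complex.normSq_apply, Complex.normSq_eq_norm_sq, hy, one_pow]
  have hz : z = (starRingEnd ℂ) (x * y) := by
    have h1 : x * y * (starRingEnd ℂ) (x * y) = 1 := by
      rw [Complex.mul_conj', norm_mul, hx, hy]; simp
    have h0 : x * y ≠ 0 := left_ne_zero_of_mul_eq_one h1
    exact mul_left_cancel₀ h0 (hxyz.trans h1.symm)
  have hzre : z.re = x.re * y.re - x.im * y.im := by simp [hz]
  simp only [Complex.add_re, hzre]
  obtain ⟨a, b⟩ := x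
  obtain ⟨c, d⟩ := y
  simp only at hxx hyy ⊢
  -- `P = cos² ((α + β) / 2)` and `Q = cos² ((α - β) / 2)` for `x = exp (iα)`, `y = exp (iβ)`
  obtain ⟨P, hP⟩ : ∃ P, P = (1 + a * c - b * d) / 2 := ⟨_, rfl⟩
  obtain ⟨Q, hQ⟩ : ∃ Q, Q = (1 + a * c + b * d) / 2 := ⟨_, rfl⟩
  have hT : (a + c) ^ 2 = 4 * P * Q := by
    subst hP hQ
    linear_combination d ^ 2 * hxx + (1 - a ^ 2) * hyy
  have hP0 : 0 ≤ P := by subst hP; nlinarith [sq_nonneg (a + c), sq_nonneg (b - d)]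
  have hQ1 : 0 ≤ 1 - Q := by subst hQ; nlinarith [sq_nonneg (a - c), sq_nonneg (b - d)]
  have hre : a + c + (a * c - b * d) = (a + c) + 2 * P - 1 := by subst hP; ring
  rw [hre]
  have hPQ := mul_nonneg hP0 hQ1
  constructor
  · nlinarith [sq_nonneg (2 * P - 1 / 2), sq_nonneg (a + c + (2 * P + 1 / 2))]
  · intro h
    have h1 : a + c = -(2 * P + 1 / 2) := by linarith
    rw [h1] at hT
    have h2 : (2 * P - 1 / 2) ^ 2 = 0 := by linarith [sq_nonneg (2 * P - 1 / 2)]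
    have h3 : P = 1 / 4 := by linarith [(pow_eq_zero_iff two_ne_zero).mp h2]
    have h4 : Q = 1 := by rw [h3] at hT; linarith
    rw [hQ] at h4
    have h5 : (a - c) ^ 2 + (b - d) ^ 2 = 0 := by linear_combination hxx + hyy - 4 * h4
    have h6 : a - c = 0 :=
      (pow_eq_zero_iff two_ne_zero).mp (by linarith [sq_nonneg (a - c), sq_nonneg (b - d)])
    have h7 : b - d = 0 :=
      (pow_eq_zero_iff two_ne_zero).mp (by linarith [sq_nonneg (a - c), sq_nonneg (b - d)])
    rw [sub_eq_zero.mp h6, sub_eq_zero.mp h7]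

end UnitComplex

section ZModChar

theorem ZMod.norm_stdAddChar {N : ℕ} [NeZero N] (x : ZMod N) : ‖ZMod.stdAddChar x‖ = 1 := by
  rw [ZMod.stdAddChar_apply, Circle.norm_coe]

theorem ZMod.conj_stdAddChar {N : ℕ} [NeZero N] (x : ZMod N) :
    (starRingEnd ℂ) (ZMod.stdAddChar x) = ZMod.stdAddChar (-x) := by
  rw [AddChar.map_neg_eq_inv, Complex.inv_eq_conj (ZMod.norm_stdAddChar x)]

theorem ZMod.re_stdAddChar_three {x : ZMod 3} (hx : x ≠ 0) :
    (ZMod.stdAddChar x).re = -(1 / 2) := by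
  have h1 : (ZMod.stdAddChar (1 : ZMod 3)).re = -(1 / 2) := by
    have h := ZMod.stdAddChar_coe (N := 3) 1
    rw [Int.cast_one] at h
    have h2 : (2 * (Real.pi : ℂ) * Complex.I * ((1 : ℤ) : ℂ) / ((3 : ℕ) : ℂ)) =
        ((Real.pi - Real.pi / 3 : ℝ) : ℂ) * Complex.I := by push_cast; ring
    rw [h, h2, Complex.exp_ofReal_mul_I_re, Real.cos_pi_sub, Real.cos_pi_div_three]
  have hx' : x = 1 ∨ x = -1 := by
    revert x; decide
  rcases hx' with rfl | rfl
  · exact h1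
  · rw [← ZMod.conj_stdAddChar, Complex.conj_re, h1]

/-- The Fourier transform of `‖x̂‖²` is the autocorrelation of `x`. -/
theorem ZMod.sum_norm_sq_mul_stdAddChar {N : ℕ} [NeZero N] (x : ZMod N → ℂ) (s : ZMod N) :
    ∑ m, ((‖∑ j, x j * ZMod.stdAddChar (m * j)‖ ^ 2 : ℝ) : ℂ) * ZMod.stdAddChar (m * s) =
      N * ∑ j, x j * (starRingEnd ℂ) (x (j + s)) := by
  have h1 (m : ZMod N) : ((‖∑ j, x j * ZMod.stdAddChar (m * j)‖ ^ 2 : ℝ) : ℂ) *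
      ZMod.stdAddChar (m * s) = ∑ j, ∑ l, x j * (starRingEnd ℂ) (x l) *
        ZMod.stdAddChar (m * (j - l + s)) := by
    rw [Complex.ofReal_pow, ← Complex.mul_conj', map_sum, Finset.sum_mul_sum, Finset.sum_mul]
    refine Finset.sum_congr rfl fun j _ => ?_
    rw [Finset.sum_mul]
    refine Finset.sum_congr rfl fun l _ => ?_
    rw [map_mul (starRingEnd ℂ), ZMod.conj_stdAddChar, mul_add, mul_sub, AddChar.map_add_eq_mul,
      sub_eq_add_neg, AddChar.map_add_eq_mul]
    ring
  simp_rw [h1]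
  rw [Finset.sum_comm, Finset.mul_sum]
  refine Finset.sum_congr rfl fun j _ => ?_
  rw [Finset.sum_comm]
  simp_rw [← Finset.mul_sum, AddChar.sum_mulShift _ (ZMod.isPrimitive_stdAddChar N)]
  rw [Finset.sum_eq_single (j + s)]
  · rw [if_pos (by ring), ZMod.card]; ring
  · intro l _ hl
    rw [if_neg, Nat.cast_zero, mul_zero]
    intro h
    exact hl (by linear_combination -h)
  · simp

theorem ZMod.sum_range_natCast {N : ℕ} [NeZero N] (f : ZMod N → ℂ) :
    ∑ j ∈ Finset.range N, f (j : ZMod N) = ∑ j, f j := by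
  refine Finset.sum_nbij' (fun j => (j : ZMod N)) ZMod.val (by simp)
    (fun j _ => Finset.mem_range.mpr (ZMod.val_lt j)) ?_ (by simp) (by simp)
  intro j hj
  exact ZMod.val_cast_of_lt (Finset.mem_range.mp hj)

end ZModChar

/-! ### Exponential sums of Barlow packings -/

namespace BarlowData

variable (B : BarlowData)

instance : NeZero B.k := ⟨B.k_pos.ne'⟩

/-- `t` has integral inner products `m₁, m₂, m₃` with `v₁, v₂, v₃`, with `m₁ + m₂` in the class `r`
modulo `3` and `m₃` in the class `m` modulo `k`. The structure factor of the packing at `t`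
depends only on `(r, m)`. -/
def HasType (t : EuclideanSpace ℝ (Fin 3)) (r : ZMod 3) (m : ZMod B.k) : Prop :=
  ∃ m₁ m₂ m₃ : ℤ, inner ℝ B.v₁ t = m₁ ∧ inner ℝ B.v₂ t = m₂ ∧ inner ℝ B.v₃ t = m₃ ∧
    ((m₁ + m₂ : ℤ) : ZMod 3) = r ∧ (m₃ : ZMod B.k) = m

variable {B}

theorem HasType.sub {s t : EuclideanSpace ℝ (Fin 3)} {r r' : ZMod 3} {m m' : ZMod B.k}
    (hs : B.HasType s r m) (ht : B.HasType t r' m') : B.HasType (s - t) (r - r') (m - m') := by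
  obtain ⟨a, b, c, ha, hb, hc, hr, hm⟩ := hs
  obtain ⟨a', b', c', ha', hb', hc', hr', hm'⟩ := ht
  refine ⟨a - a', b - b', c - c', ?_, ?_, ?_, ?_, ?_⟩
  · rw [inner_sub_right, ha, ha']; push_cast; rfl
  · rw [inner_sub_right, hb, hb']; push_cast; rfl
  · rw [inner_sub_right, hc, hc']; push_cast; rfl
  · rw [← hr, ← hr']; push_cast; ring
  · rw [← hm, ← hm']; push_cast; ring

theorem HasType.unique {t : EuclideanSpace ℝ (Fin 3)} {r r' : ZMod 3} {m m' : ZMod B.k}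
    (h : B.HasType t r m) (h' : B.HasType t r' m') : r = r' ∧ m = m' := by
  obtain ⟨a, b, c, ha, hb, hc, rfl, rfl⟩ := h
  obtain ⟨a', b', c', ha', hb', hc', rfl, rfl⟩ := h'
  have h1 : a = a' := by exact_mod_cast ha.symm.trans ha'
  have h2 : b = b' := by exact_mod_cast hb.symm.trans hb'
  have h3 : c = c' := by exact_mod_cast hc.symm.trans hc'
  subst h1 h2 h3
  exact ⟨rfl, rfl⟩

theorem HasType.zero : B.HasType 0 0 0 := ⟨0, 0, 0, by simp, by simp, by simp, by simp, by simp⟩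

theorem HasType.add {s t : EuclideanSpace ℝ (Fin 3)} {r r' : ZMod 3} {m m' : ZMod B.k}
    (hs : B.HasType s r m) (ht : B.HasType t r' m') : B.HasType (s + t) (r + r') (m + m') := by
  have := hs.sub (HasType.zero.sub ht)
  simpa using this

theorem mem_dualLattice_iff {t : EuclideanSpace ℝ (Fin 3)} :
    t ∈ dualLattice B.lattice ↔ ∃ r m, B.HasType t r m := by
  rw [lattice, mem_dualLattice_span]
  constructor
  · intro h
    obtain ⟨a, ha⟩ := h 0
    obtain ⟨b, hb⟩ := h 1
    obtain ⟨c, hc⟩ := h 2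
    exact ⟨_, _, a, b, c, ha, hb, hc, rfl, rfl⟩
  · rintro ⟨_, _, a, b, c, ha, hb, hc, -, -⟩ i
    fin_cases i
    · exact ⟨a, ha⟩
    · exact ⟨b, hb⟩
    · exact ⟨c, hc⟩

theorem exists_hasType (B : BarlowData) (r : ZMod 3) (m : ZMod B.k) : ∃ t, B.HasType t r m := by
  obtain ⟨b, hb⟩ := B.exists_basis
  obtain ⟨t, ht⟩ := exists_forall_inner_eq b ![((r.val : ℤ) : ℝ), 0, ((m.val : ℤ) : ℝ)]
  rw [hb] at ht
  exact ⟨t, r.val, 0, m.val, ht 0, by simpa using ht 1, ht 2, by simp, by simp⟩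

/-- The exponential sum over the layers attached to the classes `r` modulo `3` and `m` modulo
`k`. -/
noncomputable def layerSum (B : BarlowData) (r : ZMod 3) (m : ZMod B.k) : ℂ :=
  ∑ j, ZMod.stdAddChar (r * B.a j) * ZMod.stdAddChar (m * j)

theorem shift_injOn (B : BarlowData) : Set.InjOn B.shift (Finset.range B.k) := by
  intro i hi j hj h
  refine B.eq_of_shift_sub_mem (Finset.mem_range.mp hi) (Finset.mem_range.mp hj) ?_
  rw [h, sub_self]
  exact zero_mem _

theorem card_reps_packing (B : BarlowData) : B.packing.reps.card = B.k := by
  change ((Finset.range B.k).image B.shift).card = B.k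
  rw [Finset.card_image_of_injOn B.shift_injOn, Finset.card_range]

theorem HasType.fourierChar_shift {t : EuclideanSpace ℝ (Fin 3)} {r : ZMod 3} {m : ZMod B.k}
    (ht : B.HasType t r m) (j : ℕ) : (Real.fourierChar (inner ℝ (B.shift j) t) : ℂ) =
      ZMod.stdAddChar (r * B.a j) * ZMod.stdAddChar (m * (j : ZMod B.k)) := by
  obtain ⟨a, b, c, ha, hb, hc, rfl, rfl⟩ := ht
  have h1 : ((a + b : ℤ) : ZMod 3) * B.a j =
      (((a + b) * ((B.a j).val : ℤ) : ℤ) : ZMod 3) := by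
    push_cast; rw [ZMod.natCast_zmod_val]
  have h2 : (c : ZMod B.k) * (j : ZMod B.k) = ((c * (j : ℤ) : ℤ) : ZMod B.k) := by push_cast; rfl
  rw [h1, h2, ZMod.stdAddChar_coe, ZMod.stdAddChar_coe, ← Complex.exp_add, Real.fourierChar_apply]
  congr 1
  rw [shift, inner_add_left, real_inner_smul_left, real_inner_smul_left, inner_add_left, ha, hb, hc]
  push_cast
  have hk : (B.k : ℂ) ≠ 0 := by exact_mod_cast B.k_pos.ne'
  field_simp

theorem HasType.structureFactor {t : EuclideanSpace ℝ (Fin 3)} {r : ZMod 3} {m : ZMod B.k}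
    (ht : B.HasType t r m) : B.packing.structureFactor t = (1 / (B.k : ℂ)) * B.layerSum r m := by
  rw [PeriodicConfiguration.structureFactor, card_reps_packing]
  congr 1
  change ∑ v ∈ (Finset.range B.k).image B.shift, _ = _
  rw [Finset.sum_image B.shift_injOn, layerSum, ← ZMod.sum_range_natCast]
  exact Finset.sum_congr rfl fun j _ => ht.fourierChar_shift j

theorem HasType.norm_structureFactor_sq {t : EuclideanSpace ℝ (Fin 3)} {r : ZMod 3} {m : ZMod B.k}
    (ht : B.HasType t r m) :
    ‖B.packing.structureFactor t‖ ^ 2 = ‖B.layerSum r m‖ ^ 2 / (B.k : ℝ) ^ 2 := by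
  rw [ht.structureFactor, norm_mul, mul_pow, norm_div, norm_one, Complex.norm_natCast]
  ring

theorem layerSum_zero (m : ZMod B.k) : B.layerSum 0 m = if m = 0 then (B.k : ℂ) else 0 := by
  have h : B.layerSum 0 m = ∑ j, ZMod.stdAddChar (j * m) := by
    simp [layerSum, mul_comm]
  rw [h, AddChar.sum_mulShift _ (ZMod.isPrimitive_stdAddChar B.k), ZMod.card]
  split_ifs <;> simp

theorem sum_norm_layerSum_sq (r : ZMod 3) :
    ∑ m, ‖B.layerSum r m‖ ^ 2 = (B.k : ℝ) ^ 2 := by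
  have h := ZMod.sum_norm_sq_mul_stdAddChar (fun j => ZMod.stdAddChar (r * B.a j)) 0
  simp only [mul_zero, AddChar.map_zero_eq_one, mul_one, add_zero, Complex.mul_conj',
    ZMod.norm_stdAddChar, Complex.ofReal_one, one_pow, Finset.sum_const, Finset.card_univ,
    ZMod.card, nsmul_eq_mul] at h
  rw [← Complex.ofReal_sum] at h
  rw [sq]
  exact_mod_cast h

/-- Consecutive layers differ, so the autocorrelation of the layer sequence at distance one has
real part `-1/2`, whatever the stacking. -/
theorem re_sum_norm_layerSum_sq :
    (∑ m, ((‖B.layerSum 1 m‖ ^ 2 : ℝ) : ℂ) * ZMod.stdAddChar m).re = -((B.k : ℝ) ^ 2 / 2) := by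
  have h := ZMod.sum_norm_sq_mul_stdAddChar (fun j => ZMod.stdAddChar (1 * B.a j)) 1
  simp only [mul_one] at h
  have h' : ∑ m, ((‖B.layerSum 1 m‖ ^ 2 : ℝ) : ℂ) * ZMod.stdAddChar m = _ := h
  rw [h', ← Complex.ofReal_natCast, Complex.re_ofReal_mul, Complex.re_sum]
  have hterm (j : ZMod B.k) : (ZMod.stdAddChar (1 * B.a j) *
      (starRingEnd ℂ) (ZMod.stdAddChar (1 * B.a (j + 1)))).re = -(1 / 2) := by
    rw [ZMod.conj_stdAddChar, ← AddChar.map_add_eq_mul, one_mul, one_mul]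
    refine ZMod.re_stdAddChar_three ?_
    rw [← sub_eq_add_neg]
    exact sub_ne_zero.mpr (B.a_ne j)
  rw [Finset.sum_congr rfl fun j _ => hterm j]
  simp
  ring

/-- The layers are stacked cyclically, always moving by the same offset, as in the face-centered
cubic lattice. -/
def IsCyclic (B : BarlowData) : Prop := ∃ e : ZMod 3, ∀ j, B.a (j + 1) = B.a j + e

/-- If all layers are in phase at a class with `r ≠ 0`, the ratio of the phases of consecutive
layers is constant, and so is the difference of their offsets. -/
theorem isCyclic_of_norm_layerSum {r : ZMod 3} (hr : r ≠ 0) {m : ZMod B.k}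
    (h : ‖B.layerSum r m‖ = B.k) : B.IsCyclic := by
  have hconst := Complex.eq_of_norm_sum_eq_card
    (z := fun j => ZMod.stdAddChar (r * B.a j) * ZMod.stdAddChar (m * j))
    (fun j => by rw [norm_mul, ZMod.norm_stdAddChar, ZMod.norm_stdAddChar, one_mul])
    (by rw [ZMod.card]; exact h)
  have hstep (j : ZMod B.k) : ZMod.stdAddChar (r * (B.a (j + 1) - B.a j)) =
      ZMod.stdAddChar (-m) := by
    have h1 := hconst (j + 1) j
    have h2 : r * B.a (j + 1) = r * (B.a (j + 1) - B.a j) + r * B.a j := by ring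
    rw [h2, mul_add, mul_one, AddChar.map_add_eq_mul, AddChar.map_add_eq_mul] at h1
    have hu (N : ℕ) [NeZero N] (x : ZMod N) : ZMod.stdAddChar x ≠ 0 := by
      rw [← norm_pos_iff, ZMod.norm_stdAddChar]; exact one_pos
    rw [AddChar.map_neg_eq_inv]
    refine eq_inv_of_mul_eq_one_left ?_
    refine mul_right_cancel₀ (mul_ne_zero (hu _ (r * B.a j)) (hu _ (m * j))) ?_
    linear_combination h1
  refine ⟨B.a (0 + 1) - B.a 0, fun j => ?_⟩
  have h1 := ZMod.injective_stdAddChar ((hstep j).trans (hstep 0).symm)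
  have h2 := mul_left_cancel₀ hr h1
  rw [← h2]; ring

end BarlowData

/-! ### A formal dual forces cyclic stacking -/

namespace PeriodicConfiguration

variable {n : ℕ}

theorem mem_carrier_of_mem_reps {Q : PeriodicConfiguration n} {v : EuclideanSpace ℝ (Fin n)}
    (hv : v ∈ Q.reps) : v ∈ Q.carrier := ⟨v, hv, by simp⟩

open Classical in
/-- For each `w` at most one `v` contributes a pair, since the cosets are distinct. -/
theorem pairCount_eq_sum (Q : PeriodicConfiguration n) (z : EuclideanSpace ℝ (Fin n)) :
    Q.pairCount z =
      ∑ w : Q.reps, if (w : EuclideanSpace ℝ (Fin n)) + z ∈ Q.carrier then 1 else 0 := by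
  rw [Finset.sum_boole, Nat.cast_id]
  have hadd (v w : EuclideanSpace ℝ (Fin n)) : w + z - v = z - v + w := by abel
  refine Finset.card_bij' (fun p hp => ⟨p.2, (Finset.mem_product.mp (Finset.mem_filter.mp hp).1).2⟩)
    (fun w hw => (((Finset.mem_filter.mp hw).2).choose, w)) ?_ ?_ ?_ ?_
  · intro p hp
    obtain ⟨h1, h2⟩ := Finset.mem_filter.mp hp
    exact Finset.mem_filter.mpr ⟨Finset.mem_univ _, p.1, (Finset.mem_product.mp h1).1,
      by rw [hadd]; exact h2⟩
  · intro w hw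
    have h := ((Finset.mem_filter.mp hw).2).choose_spec
    exact Finset.mem_filter.mpr ⟨Finset.mem_product.mpr ⟨h.1, w.2⟩, by rw [← hadd]; exact h.2⟩
  · intro p hp
    obtain ⟨h1, h2⟩ := Finset.mem_filter.mp hp
    obtain ⟨h3, h4⟩ := Finset.mem_product.mp h1
    have hex : p.2 + z ∈ Q.carrier := ⟨p.1, h3, by rw [hadd]; exact h2⟩
    refine Prod.ext (Q.distinct _ hex.choose_spec.1 _ h3 ?_) rfl
    have := Q.lattice.sub_mem h2 hex.choose_spec.2
    rw [← hadd, sub_sub_sub_cancel_left] at this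
    exact this
  · intro w hw
    rfl

theorem pairCount_pos {Q : PeriodicConfiguration n} {v w : EuclideanSpace ℝ (Fin n)}
    (hv : v ∈ Q.carrier) (hw : w ∈ Q.carrier) : 0 < Q.pairCount (v - w) := by
  obtain ⟨v', hv', hv⟩ := hv
  obtain ⟨w', hw', hw⟩ := hw
  classical
  refine Finset.card_pos.mpr ⟨(v', w'),
    Finset.mem_filter.mpr ⟨Finset.mem_product.mpr ⟨hv', hw'⟩, ?_⟩⟩
  have h : v - w - v' + w' = (v - v') - (w - w') := by abel
  rw [h]
  exact Q.lattice.sub_mem hv hw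

theorem add_mem_carrier_of_mem_lattice {Q : PeriodicConfiguration n}
    {v γ : EuclideanSpace ℝ (Fin n)} (hv : v ∈ Q.carrier) (hγ : γ ∈ Q.lattice) :
    v + γ ∈ Q.carrier := by
  obtain ⟨w, hw, h⟩ := hv
  exact ⟨w, hw, by rw [add_sub_right_comm]; exact Q.lattice.add_mem h hγ⟩

theorem pairCount_of_mem_lattice {Q : PeriodicConfiguration n} {γ : EuclideanSpace ℝ (Fin n)}
    (hγ : γ ∈ Q.lattice) : Q.pairCount γ = Q.reps.card := by
  classical
  rw [pairCount_eq_sum, Finset.sum_boole, Nat.cast_id,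
    show Q.reps.card = (Finset.univ : Finset Q.reps).card by simp, Finset.card_filter_eq_iff]
  exact fun w _ => add_mem_carrier_of_mem_lattice (mem_carrier_of_mem_reps w.2) hγ

end PeriodicConfiguration

namespace BarlowData

open PeriodicConfiguration

variable {B : BarlowData} {Q : PeriodicConfiguration 3}

theorem HasType.pairCount_eq (hQ : B.packing.FormallyDual Q) {t : EuclideanSpace ℝ (Fin 3)}
    {r : ZMod 3} {m : ZMod B.k} (ht : B.HasType t r m) :
    (Q.pairCount t : ℝ) = Q.reps.card * (‖B.layerSum r m‖ ^ 2 / (B.k : ℝ) ^ 2) := by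
  classical
  rw [hQ.pairCount_eq t, if_pos, ht.norm_structureFactor_sq]
  exact mem_dualLattice_iff.mpr ⟨r, m, ht⟩

theorem HasType.norm_layerSum_eq (hQ : B.packing.FormallyDual Q) {t : EuclideanSpace ℝ (Fin 3)}
    {r : ZMod 3} {m : ZMod B.k} (ht : B.HasType t r m) (h : Q.pairCount t = Q.reps.card) :
    ‖B.layerSum r m‖ = B.k := by
  have h1 := ht.pairCount_eq hQ
  have hM : (0 : ℝ) < Q.reps.card := by exact_mod_cast Q.card_reps_pos
  have hk : (0 : ℝ) < B.k := by exact_mod_cast B.k_pos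
  rw [h] at h1
  have h2 : ‖B.layerSum r m‖ ^ 2 / (B.k : ℝ) ^ 2 = 1 :=
    mul_left_cancel₀ hM.ne' (by rw [mul_one]; exact h1.symm)
  rw [div_eq_one_iff_eq (by positivity)] at h2
  exact (sq_eq_sq₀ (norm_nonneg _) hk.le).mp h2

theorem exists_hasType_sub (hQ : B.packing.FormallyDual Q) {v w : EuclideanSpace ℝ (Fin 3)}
    (hv : v ∈ Q.carrier) (hw : w ∈ Q.carrier) : ∃ r m, B.HasType (v - w) r m := by
  classical
  have h := pairCount_pos hv hw
  have h1 := hQ.pairCount_eq (v - w)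
  by_contra hcon
  rw [← mem_dualLattice_iff] at hcon
  change v - w ∉ dualLattice B.packing.lattice at hcon
  rw [if_neg hcon, mul_zero] at h1
  exact h.ne' (by exact_mod_cast h1)

/-- Two points of a formal dual in the same class modulo `3` are congruent modulo `k`, because
`layerSum 0 m` vanishes for `m ≠ 0`. -/
theorem HasType.eq_zero (hQ : B.packing.FormallyDual Q) {v w : EuclideanSpace ℝ (Fin 3)}
    (hv : v ∈ Q.carrier) (hw : w ∈ Q.carrier) {m : ZMod B.k} (ht : B.HasType (v - w) 0 m) :
    m = 0 := by
  by_contra hm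
  have h := pairCount_pos hv hw
  have h1 := ht.pairCount_eq hQ
  rw [layerSum_zero, if_neg hm] at h1
  simp only [norm_zero, ne_eq, OfNat.ofNat_ne_zero, not_false_eq_true, zero_pow, zero_div,
    mul_zero] at h1
  exact h.ne' (by exact_mod_cast h1)

/-- From every translation vector of a formal dual there is exactly one step into the next class
modulo `3`: there is at most one by `HasType.eq_zero`, and by Parseval's identity the number of
steps is one on average. -/
theorem exists_step (hQ : B.packing.FormallyDual Q) {z : ZMod B.k → EuclideanSpace ℝ (Fin 3)}
    (hz : ∀ m, B.HasType (z m) 1 m) (w : Q.reps) :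
    ∃ m, ∀ m', (w : EuclideanSpace ℝ (Fin 3)) + z m' ∈ Q.carrier ↔ m' = m := by
  classical
  have huniq (w : Q.reps) {m m' : ZMod B.k} (hm : (w : EuclideanSpace ℝ (Fin 3)) + z m ∈ Q.carrier)
      (hm' : (w : EuclideanSpace ℝ (Fin 3)) + z m' ∈ Q.carrier) : m = m' := by
    refine sub_eq_zero.mp (HasType.eq_zero hQ hm hm' ?_)
    rw [add_sub_add_left_eq_sub]
    simpa using (hz m).sub (hz m')
  have hle (w : Q.reps) : ∑ m, (if (w : EuclideanSpace ℝ (Fin 3)) + z m ∈ Q.carrier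
      then 1 else 0) ≤ 1 := by
    rw [Finset.sum_boole, Nat.cast_id, Finset.card_le_one]
    intro m hm m' hm'
    exact huniq w (Finset.mem_filter.mp hm).2 (Finset.mem_filter.mp hm').2
  have hsum : ∑ m, Q.pairCount (z m) = Q.reps.card := by
    have : ∑ m, (Q.pairCount (z m) : ℝ) = Q.reps.card := by
      have hk : (B.k : ℝ) ^ 2 ≠ 0 := by have := B.k_pos; positivity
      simp_rw [fun m => (hz m).pairCount_eq hQ]
      rw [← Finset.mul_sum, ← Finset.sum_div, sum_norm_layerSum_sq, div_self hk, mul_one]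
    exact_mod_cast this
  simp_rw [pairCount_eq_sum] at hsum
  rw [Finset.sum_comm, ← Fintype.card_coe, Fintype.card_eq_sum_ones] at hsum
  have h1 := (Finset.sum_eq_sum_iff_of_le fun w _ => hle w).mp hsum w (Finset.mem_univ w)
  rw [Finset.sum_boole, Nat.cast_id, Finset.card_eq_one] at h1
  obtain ⟨m, hm⟩ := h1
  refine ⟨m, fun m' => ?_⟩
  have := Finset.ext_iff.mp hm m'
  simpa using this

/-- A periodic Barlow packing with a formal dual is cyclically stacked. -/
theorem isCyclic_of_formallyDual (hQ : B.packing.FormallyDual Q) : B.IsCyclic := by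
  classical
  -- at a period of the dual of class `r ≠ 0` the structure factor has modulus one
  by_cases hΓ : ∃ γ ∈ Q.lattice, ∃ r m, B.HasType γ r m ∧ r ≠ 0
  · obtain ⟨γ, hγ, r, m, ht, hr⟩ := hΓ
    exact isCyclic_of_norm_layerSum hr (ht.norm_layerSum_eq hQ (pairCount_of_mem_lattice hγ))
  push Not at hΓ
  obtain ⟨q, hq⟩ := Q.nonempty
  have hqC := mem_carrier_of_mem_reps hq
  -- every period of the dual has type `(0, 0)`
  have hlat {γ} (hγ : γ ∈ Q.lattice) : B.HasType γ 0 0 := by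
    have h1 := add_mem_carrier_of_mem_lattice hqC hγ
    obtain ⟨r, m, ht⟩ := exists_hasType_sub hQ h1 hqC
    rw [add_sub_cancel_left] at ht
    have hr := hΓ γ hγ r m ht
    subst hr
    have hm := HasType.eq_zero hQ h1 hqC (m := m) (by rwa [add_sub_cancel_left])
    rwa [hm] at ht
  -- classes modulo `3` and `k` of the translation vectors; the first determines the second
  choose ρ κ hρκ using fun w : Q.reps => exists_hasType_sub hQ (mem_carrier_of_mem_reps w.2) hqC
  have hκ {v w : Q.reps} (h : ρ v = ρ w) : κ v = κ w := by
    have ht := (hρκ v).sub (hρκ w)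
    rw [sub_sub_sub_cancel_right, h, sub_self] at ht
    exact sub_eq_zero.mp (HasType.eq_zero hQ (mem_carrier_of_mem_reps v.2)
      (mem_carrier_of_mem_reps w.2) ht)
  choose z hz using B.exists_hasType 1
  choose D hD using exists_step hQ hz
  choose σ hσR hσ using fun w : Q.reps => (hD w (D w)).mpr rfl
  -- `S w` is the translation vector reached from `w` by the step of class `(1, D w)`
  let S (w : Q.reps) : Q.reps := ⟨σ w, hσR w⟩
  have hS (w : Q.reps) : ρ (S w) = ρ w + 1 ∧ κ (S w) = κ w + D w := by
    have h1 := ((hρκ w).add (hz (D w))).sub (hlat (hσ w))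
    have h2 : (w - q + z (D w) - (w + z (D w) - σ w) : EuclideanSpace ℝ (Fin 3)) = S w - q := by
      change _ = σ w - q
      abel
    rw [h2, sub_zero, sub_zero] at h1
    exact (hρκ (S w)).unique h1
  have hDρ {v w : Q.reps} (h : ρ v = ρ w) : D v = D w := by
    have h1 : κ (S v) = κ (S w) := hκ (by rw [(hS v).1, (hS w).1, h])
    rw [(hS v).2, (hS w).2, hκ h] at h1
    exact add_left_cancel h1
  have hinj : Function.Injective S := by
    intro v w h
    have hρ : ρ v = ρ w := by
      have := congrArg ρ h
      rw [(hS v).1, (hS w).1] at this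
      exact add_right_cancel this
    have h1 : σ v = σ w := congrArg Subtype.val h
    have h2 := Q.lattice.sub_mem (hσ v) (hσ w)
    rw [h1, hDρ hρ, sub_sub_sub_cancel_right, add_sub_add_right_eq_sub] at h2
    exact Subtype.ext (Q.distinct _ v.2 _ w.2 h2)
  have hbij : Function.Bijective S := Finite.injective_iff_bijective.mp hinj
  have hshift (f : Q.reps → ℝ) : ∑ w, f (S w) = ∑ w, f w := hbij.sum_comp f
  let χ (w : Q.reps) : ℂ := ZMod.stdAddChar (D w)
  have hk : (B.k : ℝ) ≠ 0 := by exact_mod_cast B.k_pos.ne'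
  have hre : ∑ w, (χ w).re = -((Q.reps.card : ℝ) / 2) := by
    have h1 : ∑ w, χ w = ∑ m, (Q.pairCount (z m) : ℂ) * ZMod.stdAddChar m := by
      simp_rw [pairCount_eq_sum, hD]
      push_cast
      simp_rw [Finset.sum_mul]
      rw [Finset.sum_comm]
      simp [χ]
    have h2 (m : ZMod B.k) : (Q.pairCount (z m) : ℂ) * ZMod.stdAddChar m =
        ((Q.reps.card / (B.k : ℝ) ^ 2 : ℝ) : ℂ) *
          (((‖B.layerSum 1 m‖ ^ 2 : ℝ) : ℂ) * ZMod.stdAddChar m) := by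
      rw [← mul_assoc, ← Complex.ofReal_mul, ← Complex.ofReal_natCast, (hz m).pairCount_eq hQ]
      congr 2
      ring
    rw [← Complex.re_sum, h1, Finset.sum_congr rfl fun m _ => h2 m, ← Finset.mul_sum,
      Complex.re_ofReal_mul, re_sum_norm_layerSum_sq]
    field_simp
  have hprod (w : Q.reps) : χ w * χ (S w) * χ (S (S w)) = 1 := by
    have hρ3 : ρ (S (S (S w))) = ρ w := by
      rw [(hS _).1, (hS _).1, (hS _).1, add_assoc, add_assoc]
      exact add_zero (ρ w)
    have hD3 := hκ hρ3
    rw [(hS _).2, (hS _).2, (hS _).2, add_assoc, add_assoc, add_eq_left, ← add_assoc] at hD3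
    change ZMod.stdAddChar (D w) * ZMod.stdAddChar (D (S w)) * ZMod.stdAddChar (D (S (S w))) = 1
    rw [← AddChar.map_add_eq_mul, ← AddChar.map_add_eq_mul, hD3, AddChar.map_zero_eq_one]
  have hχ (w : Q.reps) : ‖χ w‖ = 1 := ZMod.norm_stdAddChar _
  -- equality holds in the deltoid inequality at every translation vector of the dual
  have htight : ∀ w : Q.reps, (χ w + χ (S w) + χ (S (S w))).re = -(3 / 2) := by
    have hsum : ∑ _w : Q.reps, (-(3 / 2) : ℝ) = ∑ w, (χ w + χ (S w) + χ (S (S w))).re := by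
      simp only [Complex.add_re, Finset.sum_add_distrib]
      rw [hshift fun w => (χ (S w)).re, hshift fun w => (χ w).re, hre, Finset.sum_const,
        Finset.card_univ, Fintype.card_coe, nsmul_eq_mul]
      ring
    intro w
    exact ((Finset.sum_eq_sum_iff_of_le fun w _ =>
      (Complex.deltoid (hχ w) (hχ (S w)) (hprod w)).1).mp hsum w (Finset.mem_univ w)).symm
  have hDS (w : Q.reps) : D (S w) = D w :=
    (ZMod.injective_stdAddChar
      ((Complex.deltoid (hχ w) (hχ (S w)) (hprod w)).2 (htight w))).symm
  let q' : Q.reps := ⟨q, hq⟩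
  have hDconst (w : Q.reps) : D w = D q' := by
    have h3 : ∀ a b : ZMod 3, a = b ∨ a = b + 1 ∨ a = b + 1 + 1 := by decide
    rcases h3 (ρ w) (ρ q') with h | h | h
    · exact hDρ h
    · rw [hDρ (h.trans (hS q').1.symm), hDS]
    · rw [← (hS q').1, ← (hS (S q')).1] at h
      rw [hDρ h, hDS, hDS]
  refine isCyclic_of_norm_layerSum one_ne_zero ((hz (D q')).norm_layerSum_eq hQ ?_)
  rw [pairCount_eq_sum]
  simp [hD, hDconst]

end BarlowData

/-! ### Cyclic stacking and the face-centered cubic lattice -/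

section Gram

variable {E : Type*} [NormedAddCommGroup E] [InnerProductSpace ℝ E]

/-- The Gram matrix of the standard basis of the root lattice `A₃`, scaled to norm one. -/
def IsFCCBasis (w : Fin 3 → E) : Prop := ∀ i j, inner ℝ (w i) (w j) = if i = j then 1 else 1 / 2

theorem IsFCCBasis.linearIndependent {w : Fin 3 → E} (hw : IsFCCBasis w) :
    LinearIndependent ℝ w := by
  rw [Fintype.linearIndependent_iff]
  intro g hg
  have h (i : Fin 3) := congrArg (fun x => inner ℝ (w i) x) hg
  simp only [Fin.sum_univ_three, inner_add_right, inner_smul_right, inner_zero_right, hw _ _] at h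
  have h0 := h 0
  have h1 := h 1
  have h2 := h 2
  simp at h0 h1 h2
  intro i
  fin_cases i
  · show g 0 = 0
    linarith
  · show g 1 = 0
    linarith
  · show g 2 = 0
    linarith

theorem IsFCCBasis.exists_basis {w : Fin 3 → E} (hw : IsFCCBasis w)
    (hE : Module.finrank ℝ E = 3) : ∃ b : Module.Basis (Fin 3) ℝ E, ⇑b = w :=
  ⟨basisOfLinearIndependentOfCardEqFinrank hw.linearIndependent (by simp [hE]), by simp⟩

theorem IsFCCBasis.exists_isometry {w w' : Fin 3 → E} (hw : IsFCCBasis w) (hw' : IsFCCBasis w')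
    (hE : Module.finrank ℝ E = 3) : ∃ ψ : E ≃ₗᵢ[ℝ] E, ∀ i, ψ (w i) = w' i := by
  obtain ⟨b, rfl⟩ := hw.exists_basis hE
  obtain ⟨b', rfl⟩ := hw'.exists_basis hE
  let f : E ≃ₗ[ℝ] E := b.equiv b' (Equiv.refl _)
  have hf (i : Fin 3) : f (b i) = b' i := by simp [f]
  refine ⟨f.isometryOfInner fun x y => ?_, hf⟩
  rw [← b.sum_repr x, ← b.sum_repr y]
  simp only [map_sum, map_smul, hf, sum_inner, inner_sum, real_inner_smul_left, inner_smul_right,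
    hw _ _, hw' _ _]

end Gram

/-- A basis of the face-centered cubic lattice whose vectors make angles of `π / 3`. -/
noncomputable def fccBasis : Fin 3 → EuclideanSpace ℝ (Fin 3) :=
  ![!₂[1 / √2, 1 / √2, 0], !₂[1 / √2, 0, 1 / √2], !₂[0, 1 / √2, 1 / √2]]

theorem isFCCBasis_fccBasis : IsFCCBasis fccBasis := by
  have h : (√2)⁻¹ * (√2)⁻¹ = (1 / 2 : ℝ) := by
    rw [← mul_inv, Real.mul_self_sqrt (by norm_num)]; norm_num
  intro i j
  rw [PiLp.inner_apply, Fin.sum_univ_three]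
  fin_cases i <;> fin_cases j <;> simp [fccBasis, ← sq, ← h] <;> norm_num

theorem coe_span_fccBasis :
    (Submodule.span ℤ (Set.range fccBasis) : Set (EuclideanSpace ℝ (Fin 3))) = fccLattice := by
  ext x
  rw [SetLike.mem_coe, Submodule.mem_span_range_iff_exists_fun]
  constructor
  · rintro ⟨c, rfl⟩
    refine ⟨![c 0 + c 1, c 0 + c 2, c 1 + c 2], ?_, fun i => ?_⟩
    · refine ⟨c 0 + c 1 + c 2, ?_⟩
      simp [Fin.sum_univ_three]
      ring
    · fin_cases i <;>
        simp [fccBasis, Fin.sum_univ_three, ← Int.cast_smul_eq_zsmul ℝ] <;> ring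
  · rintro ⟨m, ⟨l, hl⟩, hx⟩
    rw [Fin.sum_univ_three] at hl
    refine ⟨![l - m 2, l - m 1, l - m 0], ?_⟩
    have hl' : (m 0 + m 1 + m 2 : ℝ) = l + l := by exact_mod_cast hl
    ext i
    rw [hx]
    fin_cases i <;>
      simp [fccBasis, Fin.sum_univ_three, ← Int.cast_smul_eq_zsmul ℝ] <;> field_simp <;> linarith

namespace BarlowData

variable {B : BarlowData}

theorem mem_lattice_iff {α β γ : ℝ} :
    α • B.v₁ + β • B.v₂ + γ • B.v₃ ∈ B.lattice ↔
      (∃ n : ℤ, α = n) ∧ (∃ n : ℤ, β = n) ∧ ∃ n : ℤ, γ = n := by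
  obtain ⟨b, hb⟩ := B.exists_basis
  have h : α • B.v₁ + β • B.v₂ + γ • B.v₃ = ∑ i, (![α, β, γ] : Fin 3 → ℝ) i • b i := by
    rw [hb, Fin.sum_univ_three]; rfl
  rw [lattice, ← hb, h, b.mem_span_iff_repr_mem ℤ]
  simp only [b.repr_sum_self, Fin.forall_fin_succ]
  simp [Set.mem_range, eq_comm]

theorem shift_eq (B : BarlowData) (j : ℕ) : B.shift j =
    (((B.a j).val : ℝ) / 3) • B.v₁ + (((B.a j).val : ℝ) / 3) • B.v₂ + ((j : ℝ) / B.k) • B.v₃ := by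
  rw [shift, smul_add]

theorem mem_carrier_iff {x : EuclideanSpace ℝ (Fin 3)} :
    x ∈ B.packing.carrier ↔ ∃ j < B.k, x - B.shift j ∈ B.lattice := by
  constructor
  · rintro ⟨v, hv, hx⟩
    obtain ⟨j, hj, rfl⟩ := Finset.mem_image.mp hv
    exact ⟨j, Finset.mem_range.mp hj, hx⟩
  · rintro ⟨j, hj, hx⟩
    exact ⟨_, Finset.mem_image.mpr ⟨j, Finset.mem_range.mpr hj, rfl⟩, hx⟩

theorem shift_mem_carrier (B : BarlowData) (j : ℕ) : B.shift j ∈ B.packing.carrier := by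
  rw [mem_carrier_iff]
  refine ⟨j % B.k, Nat.mod_lt _ B.k_pos, ?_⟩
  have hk : (B.k : ℝ) ≠ 0 := by exact_mod_cast B.k_pos.ne'
  have h : B.shift j - B.shift (j % B.k) =
      (0 : ℝ) • B.v₁ + (0 : ℝ) • B.v₂ + ((j / B.k : ℕ) : ℝ) • B.v₃ := by
    have hj : (j : ℝ) = B.k * (j / B.k : ℕ) + (j % B.k : ℕ) := by
      exact_mod_cast (Nat.div_add_mod j B.k).symm
    rw [shift_eq, shift_eq, ZMod.natCast_mod, add_sub_add_left_eq_sub, ← sub_smul, zero_smul,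
      zero_smul, zero_add, zero_add, ← sub_div, hj]
    congr 1
    field_simp
    ring
  rw [h, mem_lattice_iff]
  exact ⟨⟨0, by simp⟩, ⟨0, by simp⟩, ⟨((j / B.k : ℕ) : ℤ), (Int.cast_natCast _).symm⟩⟩

/-- If the packing is closed under `(x, y, z) ↦ x - y + z`, then consecutive offsets always differ
by the same amount. -/
theorem isCyclic_of_closed (h : ∀ x ∈ B.packing.carrier, ∀ y ∈ B.packing.carrier,
    ∀ z ∈ B.packing.carrier, x - y + z ∈ B.packing.carrier) : B.IsCyclic := by
  refine ⟨B.a (1 : ℕ) - B.a (0 : ℕ), fun j => ?_⟩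
  have hk : (B.k : ℝ) ≠ 0 := by exact_mod_cast B.k_pos.ne'
  obtain ⟨i, -, hi⟩ := mem_carrier_iff.mp (h _ (B.shift_mem_carrier 1) _ (B.shift_mem_carrier 0) _
    (B.shift_mem_carrier j.val))
  set p : ℝ := ((B.a (1 : ℕ)).val - (B.a (0 : ℕ)).val + (B.a (j.val : ℕ)).val -
    (B.a (i : ℕ)).val) / 3 with hp
  have heq : B.shift 1 - B.shift 0 + B.shift j.val - B.shift i =
      p • B.v₁ + p • B.v₂ + ((1 + (j.val : ℝ) - i) / B.k) • B.v₃ := by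
    simp only [shift_eq, hp]
    push_cast
    module
  rw [heq, mem_lattice_iff] at hi
  obtain ⟨⟨n, hn⟩, -, ⟨l, hl⟩⟩ := hi
  have hi' : ((i : ℕ) : ZMod B.k) = j + 1 := by
    have h1 : (1 + (j.val : ℝ) - i) = l * B.k := by rw [← hl]; field_simp
    have h2 : (1 + (j.val : ℤ) - i) = l * B.k := by exact_mod_cast h1
    have h3 := congrArg (fun x : ℤ => (x : ZMod B.k)) h2
    simp only [Int.cast_sub, Int.cast_add, Int.cast_one, Int.cast_natCast, ZMod.natCast_zmod_val,
      Int.cast_mul, ZMod.natCast_self, mul_zero] at h3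
    linear_combination -h3
  have h1 : ((B.a (1 : ℕ)).val - (B.a (0 : ℕ)).val + (B.a (j.val : ℕ)).val -
    (B.a (i : ℕ)).val : ℝ) = n * 3 := by rw [← hn, hp]; ring
  have h2 : ((B.a (1 : ℕ)).val - (B.a (0 : ℕ)).val + (B.a (j.val : ℕ)).val -
    (B.a (i : ℕ)).val : ℤ) = n * 3 := by exact_mod_cast h1
  have h3 := congrArg (fun x : ℤ => (x : ZMod 3)) h2
  have h30 : (3 : ZMod 3) = 0 := by decide
  simp only [Int.cast_sub, Int.cast_add, Int.cast_natCast, ZMod.natCast_zmod_val,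
    Int.cast_mul, Int.cast_ofNat, h30, mul_zero] at h3
  rw [← hi']
  linear_combination -h3

theorem isCyclic_of_isometry (φ : EuclideanSpace ℝ (Fin 3) ≃ᵢ EuclideanSpace ℝ (Fin 3))
    (hφ : φ '' B.packing.carrier = fccLattice) : B.IsCyclic := by
  refine isCyclic_of_closed fun x hx y hy z hz => ?_
  let ψ := φ.toRealAffineIsometryEquiv
  have hψ (u) : ψ u = φ u := rfl
  have hmem (u) : u ∈ B.packing.carrier ↔ φ u ∈ Submodule.span ℤ (Set.range fccBasis) := by
    rw [← SetLike.mem_coe, coe_span_fccBasis, ← hφ, φ.injective.mem_set_image]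
  have hmap : φ (x - y + z) = φ x - φ y + φ z := by
    rw [← hψ, ← hψ, ← hψ, ← hψ]
    have h1 := ψ.map_vadd z (x - y)
    have h2 := ψ.map_vsub x y
    simp only [vadd_eq_add, vsub_eq_sub] at h1 h2
    rw [h1, h2]
  rw [hmem] at hx hy hz ⊢
  rw [hmap]
  exact add_mem (sub_mem hx hy) hz

/-- For a cyclically stacked packing, the offset of the `j`-th layer is `a₀ ± j`, and the period
is a multiple of `3`. -/
theorem IsCyclic.exists_sign (h : B.IsCyclic) : ∃ s : ℤ, s * s = 1 ∧
    (∀ j : ℕ, B.a (j : ZMod B.k) = B.a 0 + ((s * j : ℤ) : ZMod 3)) ∧ 3 ∣ B.k := by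
  obtain ⟨e, he⟩ := h
  have he0 : e ≠ 0 := by
    rintro rfl
    exact B.a_ne 0 (by rw [he, add_zero])
  have hs : ∀ e : ZMod 3, e ≠ 0 → e = 1 ∨ e = -1 := by decide
  obtain ⟨s, hs1, rfl⟩ : ∃ s : ℤ, s * s = 1 ∧ e = (s : ZMod 3) := by
    rcases hs e he0 with rfl | rfl
    · exact ⟨1, by norm_num, by simp⟩
    · exact ⟨-1, by norm_num, by simp⟩
  have hj (j : ℕ) : B.a (j : ZMod B.k) = B.a 0 + ((s * j : ℤ) : ZMod 3) := by
    induction j with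
    | zero => simp
    | succ j ih =>
      rw [Nat.cast_succ, he, ih]
      push_cast
      ring
  refine ⟨s, hs1, hj, ?_⟩
  have h1 := hj B.k
  rw [ZMod.natCast_self, left_eq_add] at h1
  have h2 : ((B.k : ℕ) : ZMod 3) = 0 := by
    have h3 : (((s * s) * B.k : ℤ) : ZMod 3) = 0 := by
      rw [mul_assoc, Int.cast_mul, h1, mul_zero]
    rw [hs1, one_mul] at h3
    exact_mod_cast h3
  exact (ZMod.natCast_eq_zero_iff _ _).mp h2

/-- The vector from a point of one layer to a nearest point of the next layer (of the previous
layer if `s = -1`) in a cyclically stacked packing. -/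
noncomputable def stepVector (B : BarlowData) (s : ℤ) : EuclideanSpace ℝ (Fin 3) :=
  (1 / 3 : ℝ) • B.v₁ + (1 / 3 : ℝ) • B.v₂ + ((s : ℝ) / B.k) • B.v₃

theorem isFCCBasis_stepVector (B : BarlowData) {s : ℤ} (hs : s * s = 1) :
    IsFCCBasis ![B.v₁, B.v₂, B.stepVector s] := by
  have hk : (B.k : ℝ) ≠ 0 := by exact_mod_cast B.k_pos.ne'
  have h12 : inner ℝ B.v₁ B.v₂ = 1 / 2 := by
    have h := InnerProductGeometry.cos_angle_mul_norm_mul_norm B.v₁ B.v₂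
    rw [B.angle_v₁_v₂, B.norm_v₁, B.norm_v₂, Real.cos_pi_div_three] at h
    linarith
  have h21 : inner ℝ B.v₂ B.v₁ = 1 / 2 := by rw [real_inner_comm]; exact h12
  have h11 : inner ℝ B.v₁ B.v₁ = 1 := by rw [real_inner_self_eq_norm_sq, B.norm_v₁]; norm_num
  have h22 : inner ℝ B.v₂ B.v₂ = 1 := by rw [real_inner_self_eq_norm_sq, B.norm_v₂]; norm_num
  have h13 := B.orth_v₁_v₃
  have h23 := B.orth_v₂_v₃
  have h31 : inner ℝ B.v₃ B.v₁ = 0 := by rw [real_inner_comm]; exact h13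
  have h32 : inner ℝ B.v₃ B.v₂ = 0 := by rw [real_inner_comm]; exact h23
  have h33 : inner ℝ B.v₃ B.v₃ = (B.k : ℝ) ^ 2 * (2 / 3) := by
    rw [real_inner_self_eq_norm_sq, B.norm_v₃, mul_pow, Real.sq_sqrt (by norm_num)]
  have hs' : (s : ℝ) * s = 1 := by exact_mod_cast hs
  have hu1 : inner ℝ B.v₁ (B.stepVector s) = 1 / 2 := by
    simp only [stepVector, inner_add_right, inner_smul_right, h11, h12, h13]; norm_num
  have hu2 : inner ℝ B.v₂ (B.stepVector s) = 1 / 2 := by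
    simp only [stepVector, inner_add_right, inner_smul_right, h21, h22, h23]; norm_num
  have huu : inner ℝ (B.stepVector s) (B.stepVector s) = 1 := by
    simp only [stepVector, inner_add_right, inner_add_left, inner_smul_right, real_inner_smul_left,
      h11, h12, h13, h21, h22, h23, h31, h32, h33]
    have hq : (s / B.k : ℝ) * (s / B.k) * (B.k : ℝ) ^ 2 = 1 := by
      field_simp
      linear_combination hs'
    linear_combination (2 / 3) * hq
  have hu1' := (real_inner_comm B.v₁ (B.stepVector s)).trans hu1
  have hu2' := (real_inner_comm B.v₂ (B.stepVector s)).trans hu2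
  have hu : ‖B.stepVector s‖ = 1 := by
    rw [real_inner_self_eq_norm_sq] at huu
    exact (pow_eq_one_iff_of_nonneg (norm_nonneg _) two_ne_zero).mp huu
  intro i j
  fin_cases i <;> fin_cases j <;> simp [h12, h21, hu1, hu2, hu1', hu2', B.norm_v₁, B.norm_v₂, hu]

end BarlowData

/-! ### The formal dual of a cyclically stacked packing -/

namespace BarlowData

variable {B : BarlowData}

/-- The lattice spanned by a hexagonal layer and the step vector to the next layer. -/
def stepLattice (B : BarlowData) (s : ℤ) : Submodule ℤ (EuclideanSpace ℝ (Fin 3)) :=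
  Submodule.span ℤ (Set.range ![B.v₁, B.v₂, B.stepVector s])

theorem stepVector_mem (B : BarlowData) (s : ℤ) : B.stepVector s ∈ B.stepLattice s :=
  Submodule.subset_span ⟨2, rfl⟩

theorem smul_stepVector_mem_lattice {s : ℤ} (h3 : 3 ∣ B.k) (q : ℤ) :
    (q * B.k : ℤ) • B.stepVector s ∈ B.lattice := by
  obtain ⟨l, hl⟩ := h3
  have hk : (B.k : ℝ) ≠ 0 := by exact_mod_cast B.k_pos.ne'
  have hl' : (B.k : ℝ) = 3 * l := by exact_mod_cast hl
  have h : (q * B.k : ℤ) • B.stepVector s =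
      ((q * l : ℤ) : ℝ) • B.v₁ + ((q * l : ℤ) : ℝ) • B.v₂ + ((q * s : ℤ) : ℝ) • B.v₃ := by
    rw [← Int.cast_smul_eq_zsmul ℝ, stepVector]
    simp only [smul_add, smul_smul]
    congr 2
    · congr 1; push_cast; rw [hl']; ring
    · congr 1; push_cast; rw [hl']; ring
    · push_cast; field_simp
  rw [h, mem_lattice_iff]
  exact ⟨⟨_, rfl⟩, ⟨_, rfl⟩, ⟨_, rfl⟩⟩

theorem lattice_le_stepLattice {s : ℤ} (hs : s * s = 1) (h3 : 3 ∣ B.k) :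
    B.lattice ≤ B.stepLattice s := by
  have h1 : B.v₁ ∈ B.stepLattice s := Submodule.subset_span ⟨0, rfl⟩
  have h2 : B.v₂ ∈ B.stepLattice s := Submodule.subset_span ⟨1, rfl⟩
  rw [lattice, Submodule.span_le, Set.range_subset_iff]
  obtain ⟨l, hl⟩ := h3
  have hk : (B.k : ℝ) ≠ 0 := by exact_mod_cast B.k_pos.ne'
  have hl' : (B.k : ℝ) = 3 * l := by exact_mod_cast hl
  have hs' : (s : ℝ) * s = 1 := by exact_mod_cast hs
  have h : B.v₃ = (s * B.k : ℤ) • B.stepVector s - (s * l : ℤ) • B.v₁ - (s * l : ℤ) • B.v₂ := by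
    simp only [← Int.cast_smul_eq_zsmul ℝ, stepVector, smul_add, smul_smul]
    have e1 : ((s * B.k : ℤ) : ℝ) * (1 / 3) = ((s * l : ℤ) : ℝ) := by push_cast; rw [hl']; ring
    have e2 : ((s * B.k : ℤ) : ℝ) * (s / B.k) = 1 := by push_cast; field_simp; linarith
    rw [e1, e2, one_smul]
    abel
  intro i
  fin_cases i
  · exact h1
  · exact h2
  · change B.v₃ ∈ B.stepLattice s
    rw [h]
    exact sub_mem (sub_mem (Submodule.smul_mem _ _ (B.stepVector_mem s))
      (Submodule.smul_mem _ _ h1)) (Submodule.smul_mem _ _ h2)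

theorem shift_sub_mem_lattice {s : ℤ} (hs : s * s = 1)
    (ha : ∀ j : ℕ, B.a (j : ZMod B.k) = B.a 0 + ((s * j : ℤ) : ZMod 3)) (j : ℕ) :
    B.shift j - B.shift 0 - (s * j : ℤ) • B.stepVector s ∈ B.lattice := by
  have hdvd : ((3 : ℕ) : ℤ) ∣ ((B.a j).val : ℤ) - ((B.a (0 : ℕ)).val : ℤ) - s * j := by
    rw [← ZMod.intCast_zmod_eq_zero_iff_dvd]
    have := ha j
    simp only [Int.cast_sub, Int.cast_natCast, ZMod.natCast_zmod_val, this, Nat.cast_zero]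
    ring
  obtain ⟨c, hc⟩ := hdvd
  have hc' : ((B.a j).val : ℝ) - ((B.a (0 : ℕ)).val : ℝ) - s * j = 3 * c := by exact_mod_cast hc
  have hs' : (s : ℝ) * s = 1 := by exact_mod_cast hs
  have h : B.shift j - B.shift 0 - (s * j : ℤ) • B.stepVector s =
      (c : ℝ) • B.v₁ + (c : ℝ) • B.v₂ + (0 : ℝ) • B.v₃ := by
    have e1 : (c : ℝ) = (B.a j).val / 3 - (B.a (0 : ℕ)).val / 3 - (s * j : ℤ) * (1 / 3) := by
      rw [Int.cast_mul, Int.cast_natCast]; linear_combination (-1 / 3) * hc'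
    have e2 : (0 : ℝ) = j / B.k - (0 : ℕ) / B.k - (s * j : ℤ) * (s / B.k) := by
      push_cast
      linear_combination (j / B.k : ℝ) * hs'
    rw [e1, e2, shift_eq, shift_eq, stepVector, ← Int.cast_smul_eq_zsmul ℝ]
    module
  rw [h, mem_lattice_iff]
  exact ⟨⟨_, rfl⟩, ⟨_, rfl⟩, ⟨0, by simp⟩⟩

/-- A cyclically stacked packing is a translate of a lattice. -/
theorem mem_carrier_iff_sub_mem_stepLattice {s : ℤ} (hs : s * s = 1) (h3 : 3 ∣ B.k)
    (ha : ∀ j : ℕ, B.a (j : ZMod B.k) = B.a 0 + ((s * j : ℤ) : ZMod 3))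
    {x : EuclideanSpace ℝ (Fin 3)} :
    x ∈ B.packing.carrier ↔ x - B.shift 0 ∈ B.stepLattice s := by
  rw [mem_carrier_iff]
  constructor
  · rintro ⟨j, -, hj⟩
    have h1 := add_mem (lattice_le_stepLattice hs h3 hj)
      (add_mem (lattice_le_stepLattice hs h3 (shift_sub_mem_lattice hs ha j))
        (Submodule.smul_mem _ (s * j : ℤ) (B.stepVector_mem s)))
    rwa [sub_add_cancel, sub_add_sub_cancel] at h1
  · intro hx
    obtain ⟨c, hc⟩ := (Submodule.mem_span_range_iff_exists_fun ℤ).mp hx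
    rw [Fin.sum_univ_three] at hc
    change c 0 • B.v₁ + c 1 • B.v₂ + c 2 • B.stepVector s = _ at hc
    have hk0 : (B.k : ℤ) ≠ 0 := by exact_mod_cast B.k_pos.ne'
    have hk0' : (0 : ℤ) < B.k := by exact_mod_cast B.k_pos
    obtain ⟨j, hj⟩ := Int.eq_ofNat_of_zero_le (Int.emod_nonneg (s * c 2) hk0)
    have hjk := Int.emod_lt_of_pos (s * c 2) hk0'
    rw [hj] at hjk
    refine ⟨j, by exact_mod_cast hjk, ?_⟩
    have hdiv := Int.mul_ediv_add_emod (s * c 2) B.k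
    rw [hj] at hdiv
    set q := s * c 2 / B.k
    have hc2 : c 2 = (s * q) * B.k + s * j := by
      linear_combination -(c 2) * hs - s * hdiv
    have h0 : c 0 • B.v₁ + c 1 • B.v₂ ∈ B.lattice :=
      add_mem (Submodule.smul_mem _ _ (Submodule.subset_span ⟨0, rfl⟩))
        (Submodule.smul_mem _ _ (Submodule.subset_span ⟨1, rfl⟩))
    have h1 := sub_mem (add_mem h0 (smul_stepVector_mem_lattice (s := s) h3 (s * q)))
      (shift_sub_mem_lattice hs ha j)
    convert h1 using 1
    rw [hc2, add_smul, ← add_assoc] at hc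
    rw [← sub_sub_sub_cancel_right x _ (B.shift 0), ← hc]
    abel

theorem IsCyclic.exists_isometry (h : B.IsCyclic) :
    ∃ φ : EuclideanSpace ℝ (Fin 3) ≃ᵢ EuclideanSpace ℝ (Fin 3),
      φ '' B.packing.carrier = fccLattice := by
  obtain ⟨s, hs, ha, h3⟩ := h.exists_sign
  obtain ⟨ψ, hψ⟩ := (B.isFCCBasis_stepVector hs).exists_isometry isFCCBasis_fccBasis (by simp)
  refine ⟨(IsometryEquiv.subRight (B.shift 0)).trans ψ.toIsometryEquiv, ?_⟩
  have hcarrier : IsometryEquiv.subRight (B.shift 0) '' B.packing.carrier = B.stepLattice s := by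
    ext y
    rw [SetLike.mem_coe, Set.mem_image]
    constructor
    · rintro ⟨x, hx, rfl⟩
      exact (mem_carrier_iff_sub_mem_stepLattice hs h3 ha).mp hx
    · intro hy
      refine ⟨y + B.shift 0, (mem_carrier_iff_sub_mem_stepLattice hs h3 ha).mpr ?_, ?_⟩
      · rwa [add_sub_cancel_right]
      · simp
  have hrange : (ψ.toLinearEquiv.restrictScalars ℤ).toLinearMap ''
      Set.range ![B.v₁, B.v₂, B.stepVector s] = Set.range fccBasis := by
    rw [← Set.range_comp]
    exact congrArg Set.range (funext hψ)
  rw [← coe_span_fccBasis, ← hrange, ← Submodule.map_span, Submodule.map_coe]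
  change _ = ψ '' (B.stepLattice s : Set (EuclideanSpace ℝ (Fin 3)))
  rw [← hcarrier, ← Set.image_comp]
  rfl

/-- On the dual of the full lattice of translations of a cyclically stacked packing all layers are
in phase; on the remaining vectors of `dualLattice B.lattice` they cancel. -/
theorem norm_structureFactor_of_cyclic {s : ℤ} (hs : s * s = 1) (h3 : 3 ∣ B.k)
    (ha : ∀ j : ℕ, B.a (j : ZMod B.k) = B.a 0 + ((s * j : ℤ) : ZMod 3))
    {t : EuclideanSpace ℝ (Fin 3)} (ht : t ∈ dualLattice B.lattice)
    [Decidable (t ∈ dualLattice (B.stepLattice s))] :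
    ‖B.packing.structureFactor t‖ ^ 2 = if t ∈ dualLattice (B.stepLattice s) then 1 else 0 := by
  set y : ℝ := inner ℝ (B.stepVector s) t with hy
  set ζ : Circle := Real.fourierChar (s * y) with hζ
  have hs' : (s : ℝ) * s = 1 := by exact_mod_cast hs
  have hk : (B.k : ℂ) ≠ 0 := by exact_mod_cast B.k_pos.ne'
  have hphase (j : ℕ) : Real.fourierChar (inner ℝ (B.shift j) t) =
      Real.fourierChar (inner ℝ (B.shift 0) t) * ζ ^ j := by
    obtain ⟨m, hm⟩ := ht _ (shift_sub_mem_lattice hs ha j)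
    have h1 : inner ℝ (B.shift j) t = inner ℝ (B.shift 0) t + (m + j • (s * y)) := by
      rw [← Int.cast_smul_eq_zsmul ℝ, inner_sub_left, inner_sub_left, real_inner_smul_left,
        ← hy] at hm
      rw [← hm]
      push_cast
      rw [nsmul_eq_mul]
      ring
    rw [h1, AddChar.map_add_eq_mul, AddChar.map_add_eq_mul, fourierChar_intCast, one_mul,
      AddChar.map_nsmul_eq_pow]
  have hS : B.packing.structureFactor t = (1 / (B.k : ℂ)) *
      ((Real.fourierChar (inner ℝ (B.shift 0) t) : ℂ) *
        ∑ j ∈ Finset.range B.k, (ζ : ℂ) ^ j) := by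
    rw [PeriodicConfiguration.structureFactor, card_reps_packing]
    congr 1
    change ∑ v ∈ (Finset.range B.k).image B.shift, (Real.fourierChar (inner ℝ v t) : ℂ) = _
    rw [Finset.sum_image B.shift_injOn, Finset.mul_sum]
    refine Finset.sum_congr rfl fun j _ => ?_
    rw [hphase, Circle.coe_mul, Circle.coe_pow]
  have hmem : t ∈ dualLattice (B.stepLattice s) ↔ ζ = 1 := by
    rw [hζ, fourierChar_eq_one_iff, stepLattice, mem_dualLattice_span]
    rw [lattice, mem_dualLattice_span] at ht
    constructor
    · intro h
      obtain ⟨m, hm⟩ := h 2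
      exact ⟨s * m, by push_cast; rw [← hm]; rfl⟩
    · rintro ⟨m, hm⟩ i
      fin_cases i
      · exact ht 0
      · exact ht 1
      · refine ⟨s * m, ?_⟩
        change y = _
        push_cast
        linear_combination s * hm - y * hs'
  have hζk : ζ ^ B.k = 1 := by
    rw [hζ, ← AddChar.map_nsmul_eq_pow, fourierChar_eq_one_iff]
    obtain ⟨m, hm⟩ := ht _ (smul_stepVector_mem_lattice (s := s) h3 s)
    refine ⟨m, ?_⟩
    rw [← hm, ← Int.cast_smul_eq_zsmul ℝ, real_inner_smul_left, ← hy, nsmul_eq_mul]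
    push_cast
    ring
  rw [hS]
  split_ifs with h
  · rw [hmem.mp h]
    have hkr : (B.k : ℝ) ≠ 0 := by exact_mod_cast B.k_pos.ne'
    rw [norm_mul, norm_mul, Circle.norm_coe]
    simp [hkr]
  · have hζ1 : (ζ : ℂ) ≠ 1 := fun h1 => h (hmem.mpr (Circle.ext (by simpa using h1)))
    have hζk' : (ζ : ℂ) ^ B.k = 1 := by rw [← Circle.coe_pow, hζk, Circle.coe_one]
    rw [geom_sum_eq hζ1, hζk']
    simp

/-- By Poisson summation, the dual lattice is a formal dual of a cyclically stacked packing. -/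
theorem IsCyclic.hasFormalDual (h : B.IsCyclic) : B.packing.HasFormalDual := by
  classical
  obtain ⟨s, hs, ha, h3⟩ := h.exists_sign
  obtain ⟨b, hb⟩ := (B.isFCCBasis_stepVector hs).exists_basis (by simp)
  have hspan : B.stepLattice s = Submodule.span ℤ (Set.range b) := by rw [hb, stepLattice]
  obtain ⟨d, hd⟩ := exists_dual_basis b
  have hdual : dualLattice (B.stepLattice s) = Submodule.span ℤ (Set.range d) := by
    rw [hspan, dualLattice_span_eq hd]
  have hdisc : DiscreteTopology (dualLattice (B.stepLattice s)) := by
    rw [hdual]; infer_instance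
  have hZ : IsZLattice ℝ (dualLattice (B.stepLattice s)) := by
    refine ⟨?_⟩
    rw [hdual, Submodule.span_span_of_tower, d.span_eq]
  let Q : PeriodicConfiguration 3 :=
    { lattice := dualLattice (B.stepLattice s)
      discrete := hdisc
      isZLattice := hZ
      reps := {0}
      nonempty := Finset.singleton_nonempty 0
      distinct := by
        intro v hv w hw _
        rw [Finset.mem_singleton.mp hv, Finset.mem_singleton.mp hw] }
  refine ⟨Q, fun f => ?_⟩
  have hP := B.packing.avgPairSum_eq_tsum f.toComplex
  have hf : (f.toComplex : EuclideanSpace ℝ (Fin 3) → ℂ) = fun x => (f x : ℂ) := rfl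
  rw [SchwartzMap.fourier_coe, hf] at hP
  rw [hP]
  congr 1
  set g := 𝓕 fun x => (f x : ℂ)
  have hQ : Q.avgPairSum g = ∑' x : dualLattice (B.stepLattice s), g x := by
    simp only [PeriodicConfiguration.avgPairSum, Q, Finset.card_singleton, Finset.sum_singleton,
      add_zero, sub_zero, Nat.cast_one, div_one, one_mul]
  have hle : dualLattice (B.stepLattice s) ≤ dualLattice B.lattice :=
    fun t ht x hx => ht x (lattice_le_stepLattice hs h3 hx)
  rw [hQ]
  change ∑' t : (dualLattice B.lattice : Set (EuclideanSpace ℝ (Fin 3))),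
    ((‖B.packing.structureFactor t‖ ^ 2 : ℝ) : ℂ) * g t =
      ∑' x : (dualLattice (B.stepLattice s) : Set (EuclideanSpace ℝ (Fin 3))), g x
  rw [tsum_subtype (dualLattice B.lattice : Set (EuclideanSpace ℝ (Fin 3)))
      (fun t => ((‖B.packing.structureFactor t‖ ^ 2 : ℝ) : ℂ) * g t), tsum_subtype]
  refine tsum_congr fun t => ?_
  by_cases ht : t ∈ dualLattice B.lattice
  · rw [Set.indicator_of_mem ht, norm_structureFactor_of_cyclic hs h3 ha ht]
    split_ifs with ht'
    · rw [Set.indicator_of_mem ht']; simp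
    · rw [Set.indicator_of_notMem ht']; simp
  · rw [Set.indicator_of_notMem ht, Set.indicator_of_notMem fun ht' => ht (hle ht')]

end BarlowData

theorem proposition5p1 (B : BarlowData) :
    B.packing.HasFormalDual ↔
      ∃ φ : EuclideanSpace ℝ (Fin 3) ≃ᵢ EuclideanSpace ℝ (Fin 3),
        φ '' B.packing.carrier = fccLattice :=
  ⟨fun ⟨_, hQ⟩ => (BarlowData.isCyclic_of_formallyDual hQ).exists_isometry,
    fun ⟨φ, hφ⟩ => (BarlowData.isCyclic_of_isometry φ hφ).hasFormalDual⟩
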